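/- **Setting.** Let $M$ be a smooth manifold (Hausdorff, second countable), $\iota\colon C\to M$ a submanifold (injectively immersed, for instance embedded), and $D\subseteq TC$ a smooth, possibly singular, integrable distribution: every vector in $D$ extends to a smooth vector field with values in $D$, and through every point of $C$ passes an integral manifold of $D$. No regularity of $D$ is assumed. The leaves of $D$ are its maximal connected integral manifolds, and $C/D$ is the set of leaves with the final topology of $C\to C/D$. A (commutative) *coisotropic algebra* $\mathcal A=(\mathcal A_T,\mathcal A_W,\mathcal A_0)$ consists of commutative algebras $\mathcal A_T,\mathcal A_W$, an algebra morphism $\mathcal A_W\to\mathcal A_T$ and an ideal $\mathcal A_0\subseteq\mathcal A_W$. A *coisotropic $\mathcal A$-module* $\mathcal E=(\mathcal E_T,\mathcal E_W,\mathcal E_0)$ consists of an $\mathcal A_T$-module $\mathcal E_T$, an $\mathcal A_W$-module $\mathcal E_W$, a module morphism $\iota_{\mathcal E}\colon\mathcal E_W\to\mathcal E_T$ along $\mathcal A_W\to\mathcal A_T$, and a submodule $\mathcal E_0\subseteq\mathcal E_W$ with $\mathcal A_0\mathcal E_W\subseteq\mathcal E_0$. A morphism is a pair of module morphisms $(\Phi_T,\Phi_W)$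 with $\Phi_T\iota_{\mathcal E}=\iota_{\mathcal F}\Phi_W$ and $\Phi_W(\mathcal E_0)\subseteq\mathcal F_0$. A module is *regular projective* if it has the lifting property with respect to all regular epimorphisms (coequalizers) in this category. A *coisotropic index set* $N$ consists of sets $N_T$, $N_W$ and $N_0\subseteq N_W$ with a map $N_W\to N_T$; the free module on $N$ is $\mathcal A^{(N)}=\bigl(\mathcal A_T^{(N_T)},\,\mathcal A_W^{(N_W)},\,\mathcal A_W^{(N_0)}+\mathcal A_0^{(N_W)}\bigr)$. A module is *finitely generated* if it admits a regular epimorphism from $\mathcal A^{(N)}$ for some finite $N$. Let $C^\infty(M,C,D)=(C^\infty(M),C^\infty_D(M),\mathcal J_C)$, where $C^\infty_D(M)$ is the algebra of the $f\in C^\infty(M)$ with $\iota^*f$ constant along the leaves of $D$, and $\mathcal J_C=\{f \mid \iota^*f=0\}$. A *$D$-connection* on a vector bundle $E\to C$ is a map $D\times\Gamma^\infty(E)\to E$ that is the restriction of a covariant derivative $TC\times\Gamma^\infty(E)\to E$; it is *holonomy-free* if its parallel transport along curves inside leaves of $D$ depends only on the end points. For a vector bundle $E_T\to M$, subbundles $E_W\subseteq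 E_T$ and $E_0\subseteq\iota^\sharp E_W$ (where $\iota^\sharp$ denotes restriction to $C$), and a $D$-connection $\nabla$ on $\iota^\sharp E_W$ under which $E_0$ is closed, let $\Gamma^\infty(E_T,E_W,E_0,\nabla)$ be the coisotropic $C^\infty(M,C,D)$-module with components $$\Gamma^\infty(E_T),\qquad \{s\in\Gamma^\infty(E_W)\mid \nabla_X\iota^\sharp s=0\ \ \forall X\in\Gamma^\infty(D)\},\qquad \{s\in\Gamma^\infty(E_W)\mid \iota^\sharp s\in\Gamma^\infty(E_0),\ \nabla_X\iota^\sharp s=0\ \ \forall X\in\Gamma^\infty(D)\}$$ and the inclusion of sections. **Theorem.** Assume that $M$ and $C/D$ are connected. Let $\mathcal P$ be a finitely generated regular projective coisotropic $C^\infty(M,C,D)$-module. Then there exist a vector bundle $E_T\to M$, vector subbundles $E_W\subseteq E_T$ and $E_0\subseteq\iota^\sharp E_W$, and a holonomy-free $D$-connection $\nabla$ on $\iota^\sharp E_W$ such that $E_0$ is closed under $\nabla$ and $$\mathcal P\cong\Gamma^\infty(E_T,E_W,E_0,\nabla)$$ as coisotropic $C^\infty(M,C,D)$-modules. Moreover,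 $(E_T,E_W,E_0,\nabla)$ can be chosen such that there exist a vector subbundle $E_0^\perp\subseteq\iota^\sharp E_W$ with $\iota^\sharp E_W=E_0\oplus E_0^\perp$ and holonomy-free $D$-connections $\nabla^0$ on $E_0$ and $\nabla^\perp$ on $E_0^\perp$ with $\nabla=\nabla^0\oplus\nabla^\perp$. -/

import Mathlib

open scoped Manifold ContDiff Topology
open CategoryTheory Bundle

universe w v u

noncomputable section

/-! ## Coisotropic algebras and their modules -/

/-- A commutative coisotropic algebra over `k`: unital commutative `k`-algebras `Tot` and `Obs`,
an algebra homomorphism `ι : Obs → Tot` and an ideal `Null ⊆ Obs`. -/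
structure CoisoAlgebra (k : Type w) [CommRing k] where
  Tot : Type u
  Obs : Type u
  [commRingTot : CommRing Tot]
  [commRingObs : CommRing Obs]
  [algebraTot : Algebra k Tot]
  [algebraObs : Algebra k Obs]
  ι : Obs →ₐ[k] Tot
  Null : Ideal Obs

namespace CoisoAlgebra

attribute [instance] commRingTot commRingObs algebraTot algebraObs

end CoisoAlgebra

/-- A coisotropic module over a (commutative) coisotropic algebra `A`: an `A.Tot`-module `Tot`, an
`A.Obs`-module `Obs`, a module morphism `ι : Obs → Tot` along `A.ι`, and a submodule `Null ⊆ Obs`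
with `A.Null • Obs ⊆ Null`. As the algebras are commutative, left and right modules agree. -/
structure CoisoModule {k : Type w} [CommRing k] (A : CoisoAlgebra.{w, u} k) where
  Tot : Type u
  Obs : Type u
  [addCommGroupTot : AddCommGroup Tot]
  [addCommGroupObs : AddCommGroup Obs]
  [moduleTot : Module A.Tot Tot]
  [moduleObs : Module A.Obs Obs]
  ι : Obs →ₛₗ[(A.ι : A.Obs →+* A.Tot)] Tot
  Null : Submodule A.Obs Obs
  smul_mem_null : ∀ a ∈ A.Null, ∀ x : Obs, a • x ∈ Null

namespace CoisoModule

attribute [instance] addCommGroupTot addCommGroupObs moduleTot moduleObs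

variable {k : Type w} [CommRing k] {A : CoisoAlgebra.{w, u} k}

/-- Morphisms of coisotropic modules. -/
@[ext]
structure Hom (E F : CoisoModule A) where
  tot : E.Tot →ₗ[A.Tot] F.Tot
  obs : E.Obs →ₗ[A.Obs] F.Obs
  comm : ∀ x, tot (E.ι x) = F.ι (obs x)
  map_null : ∀ x ∈ E.Null, obs x ∈ F.Null

instance : Category (CoisoModule A) where
  Hom E F := Hom E F
  id E := ⟨LinearMap.id, LinearMap.id, fun _ => rfl, fun _ h => h⟩
  comp f g := ⟨g.tot ∘ₗ f.tot, g.obs ∘ₗ f.obs,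
    fun x => by simp [f.comm, g.comm], fun x h => g.map_null _ (f.map_null x h)⟩

/-- A coisotropic module is regular projective if it has the lifting property with respect to all
regular epimorphisms of coisotropic modules. -/
def RegularProjective (P : CoisoModule A) : Prop :=
  ∀ ⦃E F : CoisoModule A⦄ (Ψ : P ⟶ F) (Φ : E ⟶ F), IsRegularEpi Φ → ∃ χ : P ⟶ E, χ ≫ Φ = Ψ

end CoisoModule

/-- A coisotropic index set. -/
structure CoisoIndexSet where
  Tot : Type u
  Obs : Type u
  ι : Obs → Tot
  Null : Set Obs

namespace CoisoModule

variable {k : Type w} [CommRing k] {A : CoisoAlgebra.{w, u} k}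

/-- The free coisotropic module on a coisotropic index set `N`. -/
def free (A : CoisoAlgebra.{w, u} k) (N : CoisoIndexSet.{u}) : CoisoModule A where
  Tot := N.Tot →₀ A.Tot
  Obs := N.Obs →₀ A.Obs
  ι :=
    { toFun := fun x => (x.mapRange A.ι (map_zero A.ι)).mapDomain N.ι
      map_add' := fun x y => by
        rw [Finsupp.mapRange_add (map_add A.ι), Finsupp.mapDomain_add]
      map_smul' := fun a x => by
        rw [← Finsupp.mapDomain_smul]
        congr 1
        ext n
        simp }
  Null := Finsupp.supported A.Obs A.Obs N.Null ⊔ Finsupp.submodule fun _ => A.Null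
  smul_mem_null a ha x := Submodule.mem_sup_right fun n => by
    simpa using A.Null.mul_mem_right (x n) ha

/-- A coisotropic module is finitely generated if it is a regular quotient of a free coisotropic
module on a finite coisotropic index set. For a regular projective module such a quotient
splits off the free module as a direct summand. -/
def FinitelyGenerated (P : CoisoModule A) : Prop :=
  ∃ N : CoisoIndexSet.{u}, Finite N.Tot ∧ Finite N.Obs ∧ ∃ q : free A N ⟶ P, IsRegularEpi q

end CoisoModule

/-! ## Smooth vector bundles and subbundles -/

section Bundles

variable {m c : ℕ}
  {M : Type u} [TopologicalSpace M] [ChartedSpace (EuclideanSpace ℝ (Fin m)) M]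
  {C : Type v} [TopologicalSpace C] [ChartedSpace (EuclideanSpace ℝ (Fin c)) C]

/-- A smooth real vector bundle of constant rank over the `m`-dimensional manifold `M`. -/
structure VBundle (m : ℕ) (M : Type u) [TopologicalSpace M]
    [ChartedSpace (EuclideanSpace ℝ (Fin m)) M] where
  rank : ℕ
  Fiber : M → Type
  [addCommGroup : ∀ p, AddCommGroup (Fiber p)]
  [module : ∀ p, Module ℝ (Fiber p)]
  [topFiber : ∀ p, TopologicalSpace (Fiber p)]
  [topTotal : TopologicalSpace (TotalSpace (EuclideanSpace ℝ (Fin rank)) Fiber)]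
  [fiberBundle : FiberBundle (EuclideanSpace ℝ (Fin rank)) Fiber]
  [vectorBundle : VectorBundle ℝ (EuclideanSpace ℝ (Fin rank)) Fiber]
  [smooth : ContMDiffVectorBundle ∞ (EuclideanSpace ℝ (Fin rank)) Fiber (𝓡 m)]

namespace VBundle

attribute [instance] addCommGroup module topFiber topTotal fiberBundle vectorBundle smooth

/-- The model fibre. -/
abbrev Model (V : VBundle m M) : Type := EuclideanSpace ℝ (Fin V.rank)

/-- Smoothness on a set of a (set-theoretic) section. -/
def SmoothOn (V : VBundle m M) (s : ∀ p, V.Fiber p) (U : Set M) : Prop :=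
  ContMDiffOn (𝓡 m) ((𝓡 m).prod 𝓘(ℝ, V.Model)) ∞ (fun p => TotalSpace.mk' V.Model p (s p)) U

/-- The smooth sections `Γ^∞(V)`. -/
abbrev Sections (V : VBundle m M) : Type u := Cₛ^∞⟮𝓡 m; V.Model, V.Fiber⟯

/-- `Γ^∞(V)` is a module over `C^∞(M)`. -/
instance (V : VBundle m M) : Module C^∞⟮𝓡 m, M; ℝ⟯ V.Sections where
  smul f s := ⟨fun p => f p • s p, ContMDiff.smul_section f.contMDiff s.contMDiff⟩
  one_smul s := ContMDiffSection.ext fun p => one_smul ℝ (s p)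
  mul_smul f g s := ContMDiffSection.ext fun p => mul_smul (f p) (g p) (s p)
  smul_zero f := ContMDiffSection.ext fun p => smul_zero (f p)
  smul_add f s t := ContMDiffSection.ext fun p => smul_add (f p) (s p) (t p)
  add_smul f g s := ContMDiffSection.ext fun p => add_smul (f p) (g p) (s p)
  zero_smul s := ContMDiffSection.ext fun p => zero_smul ℝ (s p)

@[simp]
theorem smul_apply (V : VBundle m M) (f : C^∞⟮𝓡 m, M; ℝ⟯) (s : V.Sections) (p : M) :
    (f • s) p = f p • s p := rfl

/-- The pullback bundle `ι^♯ V` along a smooth map `ι : C → M`. -/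
def pullback (V : VBundle m M) (ι : C^∞⟮𝓡 c, C; 𝓡 m, M⟯) : VBundle c C where
  rank := V.rank
  Fiber := ι *ᵖ V.Fiber
  addCommGroup := fun p => inferInstanceAs (AddCommGroup (V.Fiber (ι p)))
  module := fun p => inferInstanceAs (Module ℝ (V.Fiber (ι p)))
  fiberBundle := FiberBundle.pullback ι
  vectorBundle := VectorBundle.pullback ℝ ι
  smooth := ContMDiffVectorBundle.pullback V.Model V.Fiber (𝓡 c) ι

theorem smoothOn_pullback (V : VBundle m M) (ι : C^∞⟮𝓡 c, C; 𝓡 m, M⟯) {s : ∀ p, V.Fiber p}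
    {U : Set M} (hs : V.SmoothOn s U) :
    (V.pullback ι).SmoothOn (fun p => s (ι p)) (ι ⁻¹' U) := by
  intro p hp
  have h := (contMDiffWithinAt_section (F := V.Model) (E := V.Fiber)).1 (hs (ι p) hp)
  refine (contMDiffWithinAt_section (F := (V.pullback ι).Model)
    (E := (V.pullback ι).Fiber)).2 ?_
  exact h.comp p (ι.contMDiff p).contMDiffWithinAt (fun _ h => h)

end VBundle

/-- A smooth vector subbundle of `V` (of constant rank): a family of linear subspaces of the fibres
that locally admits smooth frames. -/
structure Subbundle (V : VBundle m M) where
  rank : ℕ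
  fiber : ∀ p, Submodule ℝ (V.Fiber p)
  exists_frame : ∀ p₀ : M, ∃ U : Set M, IsOpen U ∧ p₀ ∈ U ∧
    ∃ s : Fin rank → ∀ p, V.Fiber p, (∀ i, V.SmoothOn (s i) U) ∧
      ∀ p ∈ U, LinearIndependent ℝ (fun i => s i p) ∧
        Submodule.span ℝ (Set.range fun i => s i p) = fiber p

namespace Subbundle

variable {V : VBundle m M}

/-- The smooth sections of a subbundle `S ⊆ V`, as a submodule of `Γ^∞(V)`. -/
def sections (S : Subbundle V) : Submodule C^∞⟮𝓡 m, M; ℝ⟯ V.Sections where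
  carrier := {s | ∀ p, s p ∈ S.fiber p}
  add_mem' hs ht p := (S.fiber p).add_mem (hs p) (ht p)
  zero_mem' p := (S.fiber p).zero_mem
  smul_mem' f _ hs p := (S.fiber p).smul_mem (f p) (hs p)

/-- The value of a section of the subbundle, as an element of its fibre. -/
def eval (S : Subbundle V) (s : S.sections) (p : M) : S.fiber p := ⟨s.1 p, s.2 p⟩

/-- Inclusion of subbundles. -/
instance : LE (Subbundle V) := ⟨fun S T => ∀ p, S.fiber p ≤ T.fiber p⟩

/-- If `S ⊆ T`, then every section of `S` is a section of `T`. -/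
def incl {S T : Subbundle V} (h : S ≤ T) (s : S.sections) : T.sections :=
  ⟨s.1, fun p => h p (s.2 p)⟩

/-- The pullback `ι^♯ S ⊆ ι^♯ V` of a subbundle `S ⊆ V`. -/
def pullback (S : Subbundle V) (ι : C^∞⟮𝓡 c, C; 𝓡 m, M⟯) : Subbundle (V.pullback ι) where
  rank := S.rank
  fiber p := S.fiber (ι p)
  exists_frame p₀ := by
    obtain ⟨U, hU, hp, s, hs, hf⟩ := S.exists_frame (ι p₀)
    exact ⟨ι ⁻¹' U, hU.preimage ι.contMDiff.continuous, hp, fun i p => s i (ι p),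
      fun i => V.smoothOn_pullback ι (hs i), fun p hp => hf (ι p) hp⟩

/-- The restriction `ι^♯ s ∈ Γ^∞(ι^♯ S)` of a section `s ∈ Γ^∞(S)`. -/
def restrict (S : Subbundle V) (ι : C^∞⟮𝓡 c, C; 𝓡 m, M⟯) (s : S.sections) :
    (S.pullback ι).sections :=
  ⟨⟨fun p => s.1 (ι p), contMDiffOn_univ.1
    (V.smoothOn_pullback ι (U := Set.univ) s.1.contMDiff.contMDiffOn)⟩, fun p => s.2 (ι p)⟩

end Subbundle

end Bundles

/-! ## Integrable (possibly singular) distributions -/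

section Distributions

variable {c : ℕ} {C : Type v} [TopologicalSpace C] [ChartedSpace (EuclideanSpace ℝ (Fin c)) C]
  [IsManifold (𝓡 c) ∞ C]

/-- Smooth vector fields on `C`. -/
abbrev VField (c : ℕ) (C : Type v) [TopologicalSpace C]
    [ChartedSpace (EuclideanSpace ℝ (Fin c)) C] [IsManifold (𝓡 c) ∞ C] : Type v :=
  Cₛ^∞⟮𝓡 c; EuclideanSpace ℝ (Fin c), (TangentSpace (𝓡 c) : C → Type)⟯

/-- A family of tangent subspaces, possibly of varying dimension. -/
abbrev TangentFamily (c : ℕ) (C : Type v) [TopologicalSpace C]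
    [ChartedSpace (EuclideanSpace ℝ (Fin c)) C] : Type v :=
  ∀ p : C, Submodule ℝ (TangentSpace (𝓡 c) p)

/-- A connected integral manifold of `D`: a connected injectively immersed manifold `L → C` whose
tangent spaces are exactly the subspaces `D p`. -/
structure IntegralManifold (D : TangentFamily c C) where
  dim : ℕ
  L : Type v
  [topL : TopologicalSpace L]
  [chartedL : ChartedSpace (EuclideanSpace ℝ (Fin dim)) L]
  [manifoldL : IsManifold (𝓡 dim) ∞ L]
  [connectedL : ConnectedSpace L]
  map : L → C
  immersion : Manifold.IsImmersion (𝓡 dim) (𝓡 c) ∞ map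
  injective : Function.Injective map
  range_mfderiv : ∀ x, LinearMap.range (mfderiv (𝓡 dim) (𝓡 c) map x).toLinearMap = D (map x)

attribute [instance] IntegralManifold.topL IntegralManifold.chartedL IntegralManifold.manifoldL
  IntegralManifold.connectedL

/-- A smooth, possibly singular, distribution that is integrable: every vector in `D` extends to a
smooth vector field with values in `D`, and through every point passes an integral manifold. -/
structure IntegrableDistribution (c : ℕ) (C : Type v) [TopologicalSpace C]
    [ChartedSpace (EuclideanSpace ℝ (Fin c)) C] [IsManifold (𝓡 c) ∞ C] where
  fiber : TangentFamily c C
  exists_field : ∀ (p : C) (x : TangentSpace (𝓡 c) p), x ∈ fiber p →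
    ∃ X : VField c C, (∀ q, X q ∈ fiber q) ∧ X p = x
  exists_integralManifold : ∀ p : C, ∃ N : IntegralManifold fiber, p ∈ Set.range N.map

namespace IntegrableDistribution

/-- Two points lie in the same leaf, i.e. in a common connected integral manifold. (The leaf
through a point is the largest connected integral manifold containing it.) -/
def SameLeaf (D : IntegrableDistribution c C) (p q : C) : Prop :=
  ∃ N : IntegralManifold D.fiber, p ∈ Set.range N.map ∧ q ∈ Set.range N.map

/-- The leaf space `C / D`; as a quotient it carries the final topology. -/
abbrev LeafSpace (D : IntegrableDistribution c C) : Type v := Quot D.SameLeaf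

/-- A smooth curve inside a leaf of `D`: it is smooth as a map into a connected integral manifold.
Curves are parametrized by `ℝ`; a smooth curve on a compact interval extends to such a one. -/
def IsLeafCurve (D : IntegrableDistribution c C) (γ : ℝ → C) : Prop :=
  ∃ (N : IntegralManifold D.fiber) (δ : ℝ → N.L), ContMDiff 𝓘(ℝ, ℝ) (𝓡 N.dim) ∞ δ ∧ γ = N.map ∘ δ

/-- The velocity of a curve. -/
def velocity (γ : ℝ → C) (t : ℝ) : TangentSpace (𝓡 c) (γ t) :=
  mfderiv 𝓘(ℝ, ℝ) (𝓡 c) γ t (1 : ℝ)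

theorem IsLeafCurve.velocity_mem {D : IntegrableDistribution c C} {γ : ℝ → C}
    (h : D.IsLeafCurve γ) (t : ℝ) : velocity γ t ∈ D.fiber (γ t) := by
  obtain ⟨N, δ, hδ, rfl⟩ := h
  have h1 : MDifferentiableAt (𝓡 N.dim) (𝓡 c) N.map (δ t) :=
    (N.immersion.contMDiff (δ t)).mdifferentiableAt (by simp)
  have h2 : MDifferentiableAt 𝓘(ℝ, ℝ) (𝓡 N.dim) δ t := (hδ t).mdifferentiableAt (by simp)
  have h3 := mfderiv_comp t h1 h2
  have h4 := N.range_mfderiv (δ t)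
  unfold velocity
  rw [h3]
  change _ ∈ D.fiber (N.map (δ t))
  rw [← h4]
  exact ⟨_, rfl⟩

/-- A smooth function that is constant along the leaves is annihilated by `D`. -/
theorem mvfderiv_eq_zero (D : IntegrableDistribution c C) (f : C^∞⟮𝓡 c, C; ℝ⟯)
    (hf : ∀ p q, D.SameLeaf p q → f p = f q) (p : C) (x : D.fiber p) :
    mvfderiv (𝓡 c) f p (x : TangentSpace (𝓡 c) p) = 0 := by
  obtain ⟨N, y, rfl⟩ := D.exists_integralManifold p
  obtain ⟨x, hx⟩ := x
  rw [← N.range_mfderiv y] at hx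
  obtain ⟨z, rfl⟩ := hx
  have h1 : MDifferentiableAt (𝓡 N.dim) (𝓡 c) N.map y :=
    (N.immersion.contMDiff y).mdifferentiableAt (by simp)
  have h2 : MDifferentiableAt (𝓡 c) 𝓘(ℝ, ℝ) f (N.map y) :=
    (f.contMDiff _).mdifferentiableAt (by simp)
  have h3 : (f : C → ℝ) ∘ N.map = fun _ => f (N.map y) :=
    funext fun y' => hf _ _ ⟨N, ⟨y', rfl⟩, ⟨y, rfl⟩⟩
  have h4 := mfderiv_comp y h2 h1
  rw [h3, mfderiv_const] at h4
  have h5 := congrArg (fun T => T z) h4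
  simpa [mvfderiv] using h5.symm

end IntegrableDistribution

end Distributions

/-! ## `D`-connections -/

section Connections

variable {c : ℕ} {C : Type v} [TopologicalSpace C] [ChartedSpace (EuclideanSpace ℝ (Fin c)) C]
  [IsManifold (𝓡 c) ∞ C] {V : VBundle c C}

/-- A covariant derivative `TC × Γ^∞(S) → S` on the vector bundle `S ⊆ V`. -/
structure CovariantDer (S : Subbundle V) where
  toFun : ∀ p : C, TangentSpace (𝓡 c) p → S.sections → S.fiber p
  add_left : ∀ p x y s, toFun p (x + y) s = toFun p x s + toFun p y s
  smul_left : ∀ p (a : ℝ) x s, toFun p (a • x) s = a • toFun p x s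
  add_right : ∀ p x s t, toFun p x (s + t) = toFun p x s + toFun p x t
  leibniz : ∀ p x (f : C^∞⟮𝓡 c, C; ℝ⟯) s,
    toFun p x (f • s) = f p • toFun p x s + (mvfderiv (𝓡 c) f p x : ℝ) • S.eval s p
  smooth : ∀ (X : VField c C) s, V.SmoothOn (fun p => (toFun p (X p) s : V.Fiber p)) Set.univ

/-- A `D`-connection on `S`: a map `D × Γ^∞(S) → S` that is the restriction of a covariant
derivative. -/
structure DConnection (D : IntegrableDistribution c C) (S : Subbundle V) where
  toFun : ∀ p : C, D.fiber p → S.sections → S.fiber p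
  exists_extension : ∃ cov : CovariantDer S, ∀ p x s, toFun p x s = cov.toFun p x s

namespace DConnection

variable {D : IntegrableDistribution c C} {S : Subbundle V}

/-- The section `s` of `S` is parallel: `∇_X s = 0` for all vector fields `X` with values
in `D`. -/
def IsParallel (nab : DConnection D S) (s : S.sections) : Prop :=
  ∀ (X : VField c C) (hX : ∀ p, X p ∈ D.fiber p) (p : C), nab.toFun p ⟨X p, hX p⟩ s = 0

/-- `T ⊆ S` is closed under `∇`: `∇_X s` is a section of `T` for every section `s` of `T` and
every vector field `X` with values in `D`. -/
def Preserves (nab : DConnection D S) (T : Subbundle V) (h : T ≤ S) : Prop :=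
  ∀ (X : VField c C) (hX : ∀ p, X p ∈ D.fiber p) (s : T.sections) (p : C),
    (nab.toFun p ⟨X p, hX p⟩ (Subbundle.incl h s) : V.Fiber p) ∈ T.fiber p

/-- The section `σ` of `S` along the leaf curve `γ` is parallel. Near each parameter it is written
as `σ t = ∑ i, f i t • e i (γ t)` with smooth functions `f i` and sections `e i` of `S`, and its
covariant derivative along `γ` is `∑ i, (f i)' t • e i (γ t) + f i t • ∇_{γ' t} (e i)`. -/
def IsParallelAlong (nab : DConnection D S) {γ : ℝ → C} (hγ : D.IsLeafCurve γ)
    (σ : ∀ t, S.fiber (γ t)) : Prop :=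
  ∀ t₀ : ℝ, ∃ (r : ℕ) (e : Fin r → S.sections) (f : Fin r → ℝ → ℝ),
    (∀ i, ContDiff ℝ ∞ (f i)) ∧ ∀ᶠ t in 𝓝 t₀,
      σ t = ∑ i, f i t • S.eval (e i) (γ t) ∧
      ∑ i, (deriv (f i) t • S.eval (e i) (γ t) +
        f i t • nab.toFun (γ t) ⟨IntegrableDistribution.velocity γ t, hγ.velocity_mem t⟩ (e i)) = 0

/-- Parallel transport along the leaf curve `γ`, from parameter `0` to parameter `1`, takes `x`
to `y`. -/
def Transports (nab : DConnection D S) {γ : ℝ → C} (hγ : D.IsLeafCurve γ)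
    (x : S.fiber (γ 0)) (y : S.fiber (γ 1)) : Prop :=
  ∃ σ : ∀ t, S.fiber (γ t), nab.IsParallelAlong hγ σ ∧ σ 0 = x ∧ σ 1 = y

/-- `∇` is holonomy-free: the parallel transport along curves inside leaves depends only on the
end points, i.e. there are linear maps `T p q : S p → S q` such that every curve inside a leaf from
`p` to `q` has parallel transport `T p q`. -/
def HolonomyFree (nab : DConnection D S) : Prop :=
  ∃ T : ∀ p q : C, S.fiber p →ₗ[ℝ] S.fiber q,
    ∀ (γ : ℝ → C) (hγ : D.IsLeafCurve γ) (x : S.fiber (γ 0)) (y : S.fiber (γ 1)),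
      nab.Transports hγ x y ↔ y = T (γ 0) (γ 1) x

theorem add_right (nab : DConnection D S) (p : C) (x : D.fiber p) (s t : S.sections) :
    nab.toFun p x (s + t) = nab.toFun p x s + nab.toFun p x t := by
  obtain ⟨cov, h⟩ := nab.exists_extension
  simp [h, cov.add_right]

theorem leibniz (nab : DConnection D S) (p : C) (x : D.fiber p) (f : C^∞⟮𝓡 c, C; ℝ⟯)
    (s : S.sections) :
    nab.toFun p x (f • s) = f p • nab.toFun p x s +
      (mvfderiv (𝓡 c) f p (x : TangentSpace (𝓡 c) p) : ℝ) • S.eval s p := by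
  obtain ⟨cov, h⟩ := nab.exists_extension
  simp [h, cov.leibniz]

theorem zero_right (nab : DConnection D S) (p : C) (x : D.fiber p) : nab.toFun p x 0 = 0 := by
  have h := nab.add_right p x 0 0
  simpa using h

end DConnection

end Connections

/-! ## The coisotropic algebra `C^∞(M, C, D)` and its modules of sections -/

section Main

variable {m c : ℕ}
  {M : Type u} [TopologicalSpace M] [ChartedSpace (EuclideanSpace ℝ (Fin m)) M]
  {C : Type v} [TopologicalSpace C] [ChartedSpace (EuclideanSpace ℝ (Fin c)) C]
  [IsManifold (𝓡 c) ∞ C]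

/-- `C^∞_D(M)`: the smooth functions on `M` whose restriction to `C` is constant along the leaves
of `D`. -/
def smoothObs (ι : C^∞⟮𝓡 c, C; 𝓡 m, M⟯) (D : IntegrableDistribution c C) :
    Subalgebra ℝ C^∞⟮𝓡 m, M; ℝ⟯ where
  carrier := {f | ∀ p q, D.SameLeaf p q → f (ι p) = f (ι q)}
  mul_mem' hf hg p q h := congrArg₂ (· * ·) (hf p q h) (hg p q h)
  add_mem' hf hg p q h := congrArg₂ (· + ·) (hf p q h) (hg p q h)
  algebraMap_mem' _ _ _ _ := rfl

/-- The vanishing ideal of `C`, as an ideal of `C^∞_D(M)`. -/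
def vanishingIdeal (ι : C^∞⟮𝓡 c, C; 𝓡 m, M⟯) (D : IntegrableDistribution c C) :
    Ideal (smoothObs ι D) where
  carrier := {f | ∀ p, (f : C^∞⟮𝓡 m, M; ℝ⟯) (ι p) = 0}
  add_mem' {f g} hf hg p := by
    change (f : C^∞⟮𝓡 m, M; ℝ⟯) (ι p) + (g : C^∞⟮𝓡 m, M; ℝ⟯) (ι p) = 0
    rw [hf p, hg p, add_zero]
  zero_mem' _ := rfl
  smul_mem' f g hg p := by
    change (f : C^∞⟮𝓡 m, M; ℝ⟯) (ι p) * (g : C^∞⟮𝓡 m, M; ℝ⟯) (ι p) = 0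
    rw [hg p, mul_zero]

/-- The coisotropic algebra `C^∞(M, C, D) = (C^∞(M), C^∞_D(M), J_C)`. -/
def smoothCoisoAlgebra (ι : C^∞⟮𝓡 c, C; 𝓡 m, M⟯) (D : IntegrableDistribution c C) :
    CoisoAlgebra.{0, u} ℝ where
  Tot := C^∞⟮𝓡 m, M; ℝ⟯
  Obs := smoothObs ι D
  ι := (smoothObs ι D).val
  Null := vanishingIdeal ι D

section SectionModule

variable (ι : C^∞⟮𝓡 c, C; 𝓡 m, M⟯) (D : IntegrableDistribution c C) {ET : VBundle m M}
  (EW : Subbundle ET) (E0 : Subbundle (ET.pullback ι)) (nab : DConnection D (EW.pullback ι))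

/-- The sections `s ∈ Γ^∞(E_W)` with `∇_X ι^♯ s = 0` for all `X ∈ Γ^∞(D)`. -/
def invariantSections : Submodule (smoothObs ι D) ET.Sections where
  carrier := {s | ∃ h : s ∈ EW.sections, nab.IsParallel (EW.restrict ι ⟨s, h⟩)}
  add_mem' := by
    rintro s t ⟨hs, hs'⟩ ⟨ht, ht'⟩
    refine ⟨EW.sections.add_mem hs ht, fun X hX p => ?_⟩
    have h := nab.add_right p ⟨X p, hX p⟩ (EW.restrict ι ⟨s, hs⟩) (EW.restrict ι ⟨t, ht⟩)
    rw [hs' X hX p, ht' X hX p, add_zero] at h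
    exact h
  zero_mem' := ⟨EW.sections.zero_mem, fun X hX p => nab.zero_right p ⟨X p, hX p⟩⟩
  smul_mem' := by
    rintro ⟨f, hf⟩ s ⟨hs, hs'⟩
    refine ⟨EW.sections.smul_mem f hs, fun X hX p => ?_⟩
    have h := nab.leibniz p ⟨X p, hX p⟩ (f.comp ι) (EW.restrict ι ⟨s, hs⟩)
    rw [hs' X hX p, smul_zero, zero_add, D.mvfderiv_eq_zero (f.comp ι) hf p, zero_smul] at h
    exact h

/-- The sections in `invariantSections` whose restriction to `C` takes values in `E_0`. -/
def nullSections : Submodule (smoothObs ι D) (invariantSections ι D EW nab) where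
  carrier := {s | ∀ p, (s : ET.Sections) (ι p) ∈ E0.fiber p}
  add_mem' hs ht p := (E0.fiber p).add_mem (hs p) (ht p)
  zero_mem' p := (E0.fiber p).zero_mem
  smul_mem' f _ hs p := (E0.fiber p).smul_mem ((f : C^∞⟮𝓡 m, M; ℝ⟯) (ι p)) (hs p)

/-- The inclusion of sections `Γ^∞(E_W) → Γ^∞(E_T)`. -/
def sectionInclusion : invariantSections ι D EW nab
    →ₛₗ[((smoothObs ι D).val : smoothObs ι D →+* C^∞⟮𝓡 m, M; ℝ⟯)] ET.Sections where
  toFun s := s.1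
  map_add' _ _ := rfl
  map_smul' _ _ := rfl

/-- The triple of invariant sections `Γ^∞(E_T, E_W, E_0, ∇)`, a coisotropic module over
`C^∞(M, C, D)`. -/
def sectionModule : CoisoModule (smoothCoisoAlgebra ι D) where
  Tot := ET.Sections
  Obs := invariantSections ι D EW nab
  addCommGroupTot := inferInstance
  addCommGroupObs := inferInstance
  moduleTot := inferInstanceAs (Module C^∞⟮𝓡 m, M; ℝ⟯ ET.Sections)
  moduleObs := (invariantSections ι D EW nab).module
  ι := sectionInclusion ι D EW nab
  Null := nullSections ι D EW E0 nab
  smul_mem_null f hf s p := by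
    change f.1 (ι p) • (s : ET.Sections) (ι p) ∈ E0.fiber p
    rw [hf p, zero_smul]
    exact (E0.fiber p).zero_mem

end SectionModule

end Main

end

set_option linter.unusedSectionVars false

noncomputable section

/-! ## Regular epimorphisms of coisotropic modules -/

namespace CoisoModule

variable {k : Type w} [CommRing k] {A : CoisoAlgebra.{w, u} k}

/-! A finitely generated regular projective module is a retract of a free module `A^(N)` with `N`
finite, hence the image of an idempotent endomorphism `ε`. Enlarging `N_T` by a copy of `N_W` makes
`N_W → N_T` injective (`exists_retract_free`), so that `ℝ^(N_W)` sits inside `V = ℝ^(N_T)`.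

Evaluation at points turns `ε` into matrices. On the first component they form a smooth family of
idempotents of `V` over `M`, whose ranges are the fibres of `E_T`. On the second component they form
a family on `ℝ^(N_W)`, compatible with the first by `totMap_inc`; its ranges, included in `V`, form
`E_W`. Over `C` this second family is constant along the leaves, because its entries lie in
`C^∞_D(M)` (`obsMap_leafConst`), and it preserves the coordinate subspace `ℝ^(N_0)`
(`cut_obsMap_cut`). Writing `e` for its value at a point of `C` and `π` for the projection onto
`ℝ^(N_0)`, this says `π e π = e π`. So `e π e` is again idempotent, with range `e(ℝ^(N_0))`: this is
`E_0`, and `e - e π e` cuts out `E_0^⊥`. Ranks of idempotents are traces, hence continuous. They are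
constant over the connected `M`, and for the families over `C` they descend to the connected space
`C/D`.

The connection is the Grassmann connection `q ∘ d` of the family `q` over `C`. Since `q` is constant
along leaves, `d` in directions of `D` already preserves sections of the subbundle (`deriv_eq`), so
`∇` is plain differentiation of `V`-valued functions. Hence parallel means constant along the leaves
(`isParallel_iff`), parallel transport is the identity of `V` (`holonomyFree`), and `∇` restricts to
the Grassmann connections of both summands.

Finally, coordinates of parallel sections lie in `C^∞_D(M)`. The module of sections is therefore
also a retract of `A^(N)` with idempotent `ε`, and two splittings of one idempotent are isomorphic.
-/

/-- The image of a morphism of coisotropic modules. -/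
def image {E F : CoisoModule A} (f : Hom E F) : CoisoModule A where
  Tot := LinearMap.range f.tot
  Obs := LinearMap.range f.obs
  ι :=
    { toFun := fun y => ⟨F.ι y, by
        obtain ⟨_, x, rfl⟩ := y
        exact ⟨E.ι x, f.comm x⟩⟩
      map_add' := fun x y => Subtype.ext (map_add F.ι _ _)
      map_smul' := fun a x => Subtype.ext (map_smulₛₗ F.ι _ _) }
  Null := (E.Null.map f.obs).comap (LinearMap.range f.obs).subtype
  smul_mem_null := by
    rintro a ha ⟨_, x, rfl⟩
    exact ⟨a • x, E.smul_mem_null a ha x, map_smul f.obs a x⟩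

/-- The inclusion of the image of a morphism. -/
def imageι {E F : CoisoModule A} (f : Hom E F) : image f ⟶ F where
  tot := (LinearMap.range f.tot).subtype
  obs := (LinearMap.range f.obs).subtype
  comm _ := rfl
  map_null := by
    rintro x ⟨z, hz, hzx⟩
    change x.1 ∈ F.Null
    rw [show x.1 = f.obs z from hzx.symm]
    exact f.map_null z hz

/-- The corestriction of a morphism to its image. -/
def toImage {E F : CoisoModule A} (f : Hom E F) : E ⟶ image f where
  tot := f.tot.rangeRestrict
  obs := f.obs.rangeRestrict
  comm x := Subtype.ext (f.comm x)
  map_null x hx := ⟨x, hx, rfl⟩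

theorem Hom.ext_apply {E F : CoisoModule A} {f g : E ⟶ F}
    (ht : ∀ x, Hom.tot f x = Hom.tot g x) (ho : ∀ x, Hom.obs f x = Hom.obs g x) : f = g :=
  Hom.ext (LinearMap.ext ht) (LinearMap.ext ho)

theorem mono_imageι {E F : CoisoModule A} (f : Hom E F) : Mono (imageι f) where
  right_cancellation _ _ e := Hom.ext_apply
    (fun x => Subtype.ext (congrArg (fun φ => Hom.tot φ x) e))
    (fun x => Subtype.ext (congrArg (fun φ => Hom.obs φ x) e))

/-- A morphism is surjective if it is surjective on all three components. -/
structure Hom.Surjective {E F : CoisoModule A} (f : Hom E F) : Prop where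
  tot : Function.Surjective f.tot
  obs : Function.Surjective f.obs
  null : ∀ y ∈ F.Null, ∃ x ∈ E.Null, f.obs x = y

theorem Hom.Surjective.comp {E F G : CoisoModule A} {f : E ⟶ F} {g : F ⟶ G}
    (hg : Hom.Surjective g) (hf : Hom.Surjective f) : Hom.Surjective (f ≫ g) where
  tot := hg.tot.comp hf.tot
  obs := hg.obs.comp hf.obs
  null z hz := by
    obtain ⟨y, hy, rfl⟩ := hg.null z hz
    obtain ⟨x, hx, rfl⟩ := hf.null y hy
    exact ⟨x, hx, rfl⟩

/-- Regular epimorphisms are strong, so the monomorphism `imageι f` through which `f` factors is an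
isomorphism. The null part of the image is the image of `E.Null` rather than the preimage of
`F.Null`; this yields surjectivity on the third component. -/
theorem surjective_of_isRegularEpi {E F : CoisoModule A} (f : E ⟶ F) [IsRegularEpi f] :
    Hom.Surjective f := by
  have hf : toImage f ≫ imageι f = f := rfl
  have : StrongEpi (toImage f ≫ imageι f) := by rw [hf]; infer_instance
  have : StrongEpi (imageι f) := strongEpi_of_strongEpi (toImage f) (imageι f)
  have := mono_imageι f
  have := isIso_of_mono_of_strongEpi (imageι f)
  have hi : inv (imageι f) ≫ imageι f = 𝟙 F := IsIso.inv_hom_id _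
  have hT (y : F.Tot) : (Hom.tot (imageι f)) (Hom.tot (inv (imageι f)) y) = y :=
    congrArg (fun φ => Hom.tot φ y) hi
  have hO (y : F.Obs) : (Hom.obs (imageι f)) (Hom.obs (inv (imageι f)) y) = y :=
    congrArg (fun φ => Hom.obs φ y) hi
  refine ⟨fun y => ?_, fun y => ?_, fun y hy => ?_⟩
  · obtain ⟨x, hx⟩ := (Hom.tot (inv (imageι f)) y).2
    exact ⟨x, hx.trans (hT y)⟩
  · obtain ⟨x, hx⟩ := (Hom.obs (inv (imageι f)) y).2
    exact ⟨x, hx.trans (hO y)⟩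
  · obtain ⟨x, hx, hxy⟩ := Hom.map_null (inv (imageι f)) y hy
    exact ⟨x, hx, hxy.trans (hO y)⟩

/-- The kernel of a morphism of coisotropic modules. -/
def kernel {E F : CoisoModule A} (f : Hom E F) : CoisoModule A where
  Tot := LinearMap.ker f.tot
  Obs := LinearMap.ker f.obs
  ι :=
    { toFun := fun x => ⟨E.ι x, by
        rw [LinearMap.mem_ker, f.comm, x.2, map_zero]⟩
      map_add' := fun x y => Subtype.ext (map_add E.ι _ _)
      map_smul' := fun a x => Subtype.ext (map_smulₛₗ E.ι _ _) }
  Null := E.Null.comap (LinearMap.ker f.obs).subtype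
  smul_mem_null a ha x := E.smul_mem_null a ha x.1

/-- The inclusion of the kernel of a morphism. -/
def kernelι {E F : CoisoModule A} (f : Hom E F) : kernel f ⟶ E where
  tot := (LinearMap.ker f.tot).subtype
  obs := (LinearMap.ker f.obs).subtype
  comm _ := rfl
  map_null _ h := h

/-- The zero morphism. -/
def zeroHom (E F : CoisoModule A) : E ⟶ F where
  tot := 0
  obs := 0
  comm _ := (map_zero F.ι).symm
  map_null _ _ := F.Null.zero_mem

/-- A morphism that vanishes on the kernel of a surjective morphism factors through the latter. -/
def Hom.Surjective.desc {E F G : CoisoModule A} {f : E ⟶ F} (hf : Hom.Surjective f) (g : E ⟶ G)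
    (ht : LinearMap.ker (Hom.tot f) ≤ LinearMap.ker (Hom.tot g))
    (ho : LinearMap.ker (Hom.obs f) ≤ LinearMap.ker (Hom.obs g)) : F ⟶ G :=
  have ht' (x y) (h : Hom.tot f x = Hom.tot f y) : Hom.tot g x = Hom.tot g y :=
    LinearMap.sub_mem_ker_iff.1 (ht (LinearMap.sub_mem_ker_iff.2 h))
  have ho' (x y) (h : Hom.obs f x = Hom.obs f y) : Hom.obs g x = Hom.obs g y :=
    LinearMap.sub_mem_ker_iff.1 (ho (LinearMap.sub_mem_ker_iff.2 h))
  have et := Function.surjInv_eq hf.tot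
  have eo := Function.surjInv_eq hf.obs
  { tot :=
      { toFun := fun y => Hom.tot g (Function.surjInv hf.tot y)
        map_add' := fun x y => by
          rw [← map_add]
          exact ht' _ _ (by rw [map_add, et, et, et])
        map_smul' := fun a y => by
          rw [RingHom.id_apply, ← map_smul]
          exact ht' _ _ (by rw [map_smul, et, et]) }
    obs :=
      { toFun := fun y => Hom.obs g (Function.surjInv hf.obs y)
        map_add' := fun x y => by
          rw [← map_add]
          exact ho' _ _ (by rw [map_add, eo, eo, eo])
        map_smul' := fun a y => by
          rw [RingHom.id_apply, ← map_smul]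
          exact ho' _ _ (by rw [map_smul, eo, eo]) }
    comm := fun x => by
      change Hom.tot g _ = G.ι (Hom.obs g _)
      rw [← Hom.comm g]
      exact ht' _ _ (by rw [et, Hom.comm f, eo])
    map_null := fun y hy => by
      obtain ⟨x, hx, rfl⟩ := hf.null y hy
      change Hom.obs g _ ∈ _
      rw [ho' _ x (eo _)]
      exact Hom.map_null g x hx }

theorem Hom.Surjective.fac {E F G : CoisoModule A} {f : E ⟶ F} (hf : Hom.Surjective f) (g : E ⟶ G)
    (ht : LinearMap.ker (Hom.tot f) ≤ LinearMap.ker (Hom.tot g))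
    (ho : LinearMap.ker (Hom.obs f) ≤ LinearMap.ker (Hom.obs g)) : f ≫ hf.desc g ht ho = g :=
  Hom.ext_apply
    (fun x => LinearMap.sub_mem_ker_iff.1 (ht (LinearMap.sub_mem_ker_iff.2
      (Function.surjInv_eq hf.tot (Hom.tot f x)))))
    (fun x => LinearMap.sub_mem_ker_iff.1 (ho (LinearMap.sub_mem_ker_iff.2
      (Function.surjInv_eq hf.obs (Hom.obs f x)))))

/-- Such a morphism is the coequalizer of its kernel inclusion and zero. Surjectivity on null parts
is what makes the induced morphism respect them. -/
theorem Hom.Surjective.isRegularEpi {E F : CoisoModule A} {f : E ⟶ F} (hf : Hom.Surjective f) :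
    IsRegularEpi f := by
  have hw : kernelι f ≫ f = zeroHom (kernel f) E ≫ f := Hom.ext_apply
    (fun x => x.2.trans (map_zero (Hom.tot f)).symm)
    (fun x => x.2.trans (map_zero (Hom.obs f)).symm)
  have hker {G : CoisoModule A} (g : E ⟶ G) (hg : kernelι f ≫ g = zeroHom (kernel f) E ≫ g) :
      LinearMap.ker (Hom.tot f) ≤ LinearMap.ker (Hom.tot g) ∧
      LinearMap.ker (Hom.obs f) ≤ LinearMap.ker (Hom.obs g) :=
    ⟨fun x hx => (congrArg (fun φ : kernel f ⟶ G =>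
        Hom.tot φ (⟨x, hx⟩ : LinearMap.ker (Hom.tot f))) hg).trans (map_zero (Hom.tot g)),
      fun x hx => (congrArg (fun φ : kernel f ⟶ G =>
        Hom.obs φ (⟨x, hx⟩ : LinearMap.ker (Hom.obs f))) hg).trans (map_zero (Hom.obs g))⟩
  refine ⟨⟨⟨kernel f, kernelι f, zeroHom _ _, hw, ?_⟩⟩⟩
  refine Limits.Cofork.IsColimit.mk _
    (fun s => hf.desc s.π (hker s.π s.condition).1 (hker s.π s.condition).2)
    (fun s => hf.fac _ _ _) (fun s m hm => ?_)
  refine Hom.ext_apply (fun y => ?_) (fun y => ?_)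
  · obtain ⟨x, rfl⟩ := hf.tot y
    exact (congrArg (fun φ => Hom.tot φ x) hm).trans
      (congrArg (fun φ => Hom.tot φ x) (hf.fac s.π (hker s.π s.condition).1
        (hker s.π s.condition).2)).symm
  · obtain ⟨x, rfl⟩ := hf.obs y
    exact (congrArg (fun φ => Hom.obs φ x) hm).trans
      (congrArg (fun φ => Hom.obs φ x) (hf.fac s.π (hker s.π s.condition).1
        (hker s.π s.condition).2)).symm

/-! ### Retracts of free modules -/

/-- The index set obtained from `N` by adjoining a copy of `N.Obs` to `N.Tot`. -/
def _root_.CoisoIndexSet.cover (N : CoisoIndexSet.{u}) : CoisoIndexSet.{u} where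
  Tot := N.Tot ⊕ N.Obs
  Obs := N.Obs
  ι := Sum.inr
  Null := N.Null

/-- The canonical morphism `A^(N.cover) → A^(N)`. -/
def freeCover (A : CoisoAlgebra.{w, u} k) (N : CoisoIndexSet.{u}) : free A N.cover ⟶ free A N where
  tot := Finsupp.lmapDomain A.Tot A.Tot (Sum.elim id N.ι)
  obs := LinearMap.id
  comm x :=
    (Finsupp.mapDomain_comp (f := Sum.inr) (g := Sum.elim id N.ι)
      (v := Finsupp.mapRange A.ι (map_zero A.ι) (show N.Obs →₀ A.Obs from x))).symm
  map_null _ h := h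

theorem surjective_freeCover (A : CoisoAlgebra.{w, u} k) (N : CoisoIndexSet.{u}) :
    Hom.Surjective (freeCover A N) where
  tot y :=
    ⟨Finsupp.mapDomain Sum.inl (show N.Tot →₀ A.Tot from y),
      (Finsupp.mapDomain_comp (f := Sum.inl) (g := Sum.elim id N.ι)
        (v := (show N.Tot →₀ A.Tot from y))).symm.trans Finsupp.mapDomain_id⟩
  obs := Function.surjective_id
  null y hy := ⟨y, hy, rfl⟩

/-- Lift the identity of `P` through the composite of `freeCover` and the given quotient.
Componentwise surjectivity is evidently stable under composition, which shows that this composite is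
a regular epimorphism. Injectivity of `N.ι` is what will embed `E_W` into `E_T`. -/
theorem exists_retract_free {P : CoisoModule A} (hfg : P.FinitelyGenerated)
    (hP : P.RegularProjective) :
    ∃ N : CoisoIndexSet.{u}, Finite N.Tot ∧ Finite N.Obs ∧ Function.Injective N.ι ∧
      ∃ (r : free A N ⟶ P) (i : P ⟶ free A N), i ≫ r = 𝟙 P := by
  obtain ⟨N, hT, hO, q, hq⟩ := hfg
  have h : Hom.Surjective (freeCover A N ≫ q) :=
    (surjective_of_isRegularEpi q).comp (surjective_freeCover A N)
  obtain ⟨i, hi⟩ := hP (𝟙 P) (freeCover A N ≫ q) h.isRegularEpi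
  exact ⟨N.cover, inferInstanceAs (Finite (N.Tot ⊕ N.Obs)), hO, Sum.inr_injective, _, i, hi⟩

end CoisoModule

/-! ## Vector bundles from smooth families of idempotents -/

section Idempotents

variable {V : Type*} [NormedAddCommGroup V] [NormedSpace ℝ V]

theorem exists_left_right_frames [FiniteDimensional ℝ V] {r : ℕ} (a : V →L[ℝ] V)
    (ha : ∀ v, a (a v) = a v) (hr : Module.finrank ℝ a.range = r) :
    ∃ (L : EuclideanSpace ℝ (Fin r) →L[ℝ] V) (K : V →L[ℝ] EuclideanSpace ℝ (Fin r)),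
      K ∘L a ∘L L = 1 := by
  have φ : EuclideanSpace ℝ (Fin r) ≃ₗ[ℝ] a.range :=
    LinearEquiv.ofFinrankEq _ _ (by rw [hr, finrank_euclideanSpace_fin])
  refine ⟨(a.range.subtype ∘ₗ φ.toLinearMap).toContinuousLinearMap,
    (φ.symm.toLinearMap ∘ₗ a.toLinearMap.rangeRestrict).toContinuousLinearMap, ?_⟩
  ext1 x
  obtain ⟨w, hw⟩ := (φ x).2
  have h1 : a (φ x : V) = φ x := by
    rw [← hw]
    exact ha w
  change φ.symm ⟨a (a (φ x : V)), _⟩ = x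
  rw [LinearEquiv.symm_apply_eq]
  exact Subtype.ext (by simp [h1])

variable {r : ℕ} {a : V →L[ℝ] V} {L : EuclideanSpace ℝ (Fin r) →L[ℝ] V}
  {K : V →L[ℝ] EuclideanSpace ℝ (Fin r)}

theorem injective_comp_of_isUnit (hu : IsUnit (K ∘L a ∘L L)) : Function.Injective (a ∘L L) := by
  intro x y hxy
  have h (z) : Ring.inverse (K ∘L a ∘L L) (K ((a ∘L L) z)) = z :=
    congrArg (fun T : EuclideanSpace ℝ (Fin r) →L[ℝ] EuclideanSpace ℝ (Fin r) => T z)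
      (Ring.inverse_mul_cancel _ hu)
  rw [← h x, hxy, h]

/-- Dimension count: `a ∘ L` is injective on an `r`-dimensional space and lands in the
`r`-dimensional range of `a`. -/
theorem exists_eq_comp_of_isUnit [FiniteDimensional ℝ V] (hr : Module.finrank ℝ a.range = r)
    (hu : IsUnit (K ∘L a ∘L L)) (v : V) : ∃ x, a (L x) = a v := by
  have hle : (a ∘L L).range ≤ a.range := by
    rintro _ ⟨x, rfl⟩
    exact ⟨L x, rfl⟩
  have heq : (a ∘L L).range = a.range := by
    refine Submodule.eq_of_le_of_finrank_eq hle ?_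
    rw [hr, LinearMap.finrank_range_of_inj (injective_comp_of_isUnit hu),
      finrank_euclideanSpace_fin]
  have : a v ∈ (a ∘L L).range := by
    rw [heq]
    exact ⟨v, rfl⟩
  exact this

theorem frame_inverse_apply [FiniteDimensional ℝ V] (hr : Module.finrank ℝ a.range = r)
    (hu : IsUnit (K ∘L a ∘L L)) (v : V) :
    a (L (Ring.inverse (K ∘L a ∘L L) (K (a v)))) = a v := by
  obtain ⟨x, hx⟩ := exists_eq_comp_of_isUnit hr hu v
  have h4 (z) : Ring.inverse (K ∘L a ∘L L) ((K ∘L a ∘L L) z) = z :=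
    congrArg (fun T : EuclideanSpace ℝ (Fin r) →L[ℝ] EuclideanSpace ℝ (Fin r) => T z)
      (Ring.inverse_mul_cancel _ hu)
  rw [← hx]
  exact congrArg (fun z => a (L z)) (h4 x)

end Idempotents

/-- A smooth family of idempotent endomorphisms of the vector space `V`. -/
structure IdemFamily (m : ℕ) (X : Type*) [TopologicalSpace X]
    [ChartedSpace (EuclideanSpace ℝ (Fin m)) X] (V : Type*) [NormedAddCommGroup V]
    [NormedSpace ℝ V] where
  toFun : X → V →L[ℝ] V
  smooth : ContMDiff (𝓡 m) 𝓘(ℝ, V →L[ℝ] V) ∞ toFun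
  idem : ∀ p v, toFun p (toFun p v) = toFun p v

namespace IdemFamily

variable {m : ℕ} {X : Type*} [TopologicalSpace X] [ChartedSpace (EuclideanSpace ℝ (Fin m)) X]
  {V : Type*} [NormedAddCommGroup V] [NormedSpace ℝ V]

instance : CoeFun (IdemFamily m X V) fun _ => X → V →L[ℝ] V := ⟨toFun⟩

/-- The family has constant rank `r`. -/
def HasRank (e : IdemFamily m X V) (r : ℕ) : Prop :=
  ∀ p, Module.finrank ℝ (e p).range = r

variable [FiniteDimensional ℝ V] (e : IdemFamily m X V) {r : ℕ} (hr : e.HasRank r)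

/-- A frame of the range of `e p₀`, as a map from the model fibre to `V`. -/
def frame (p₀ : X) : EuclideanSpace ℝ (Fin r) →L[ℝ] V :=
  (exists_left_right_frames (e p₀) (e.idem p₀) (hr p₀)).choose

/-- A coframe of the range of `e p₀`, as a map from `V` to the model fibre. -/
def coframe (p₀ : X) : V →L[ℝ] EuclideanSpace ℝ (Fin r) :=
  (exists_left_right_frames (e p₀) (e.idem p₀) (hr p₀)).choose_spec.choose

/-- The matrix of `e p` with respect to the frame and coframe chosen at `p₀`. -/
def gram (p₀ p : X) : EuclideanSpace ℝ (Fin r) →L[ℝ] EuclideanSpace ℝ (Fin r) :=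
  e.coframe hr p₀ ∘L e p ∘L e.frame hr p₀

theorem gram_self (p : X) : e.gram hr p p = 1 :=
  (exists_left_right_frames (e p) (e.idem p) (hr p)).choose_spec.choose_spec

theorem contMDiff_gram (p₀ : X) : ContMDiff (𝓡 m) 𝓘(ℝ, EuclideanSpace ℝ (Fin r) →L[ℝ]
    EuclideanSpace ℝ (Fin r)) ∞ (e.gram hr p₀) :=
  contMDiff_const.clm_comp (e.smooth.clm_comp contMDiff_const)

/-- The set where the frame chosen at `p₀` is mapped by `e` to a frame. -/
def frameSet (p₀ : X) : Set X := {p | IsUnit (e.gram hr p₀ p)}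

theorem isOpen_frameSet (p₀ : X) : IsOpen (e.frameSet hr p₀) :=
  Units.isOpen.preimage (e.contMDiff_gram hr p₀).continuous

theorem mem_frameSet_self (p : X) : p ∈ e.frameSet hr p := by
  change IsUnit _
  rw [gram_self]
  exact isUnit_one

theorem contMDiffOn_inverse_gram (p₀ : X) :
    ContMDiffOn (𝓡 m) 𝓘(ℝ, EuclideanSpace ℝ (Fin r) →L[ℝ] EuclideanSpace ℝ (Fin r)) ∞
      (fun p => Ring.inverse (e.gram hr p₀ p)) (e.frameSet hr p₀) := by
  rintro p ⟨g, hg⟩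
  refine ContMDiffAt.contMDiffWithinAt ?_
  have h : ContMDiffAt 𝓘(ℝ, EuclideanSpace ℝ (Fin r) →L[ℝ] EuclideanSpace ℝ (Fin r))
      𝓘(ℝ, EuclideanSpace ℝ (Fin r) →L[ℝ] EuclideanSpace ℝ (Fin r)) ∞ Ring.inverse
      (e.gram hr p₀ p) := by
    rw [← hg]
    exact (contDiffAt_ringInverse ℝ g).contMDiffAt
  exact h.comp p (e.contMDiff_gram hr p₀ p)

/-- Coordinates of `e p v` with respect to the frame chosen at `p₀`. -/
def coord (p₀ p : X) : V →L[ℝ] EuclideanSpace ℝ (Fin r) :=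
  Ring.inverse (e.gram hr p₀ p) ∘L e.coframe hr p₀ ∘L e p

theorem contMDiffOn_coord (p₀ : X) :
    ContMDiffOn (𝓡 m) 𝓘(ℝ, V →L[ℝ] EuclideanSpace ℝ (Fin r)) ∞ (e.coord hr p₀)
      (e.frameSet hr p₀) :=
  (e.contMDiffOn_inverse_gram hr p₀).clm_comp
    (contMDiff_const.clm_comp e.smooth).contMDiffOn

theorem apply_frame_coord {p₀ p : X} (hp : p ∈ e.frameSet hr p₀) (v : V) :
    e p (e.frame hr p₀ (e.coord hr p₀ p v)) = e p v :=
  frame_inverse_apply (hr p) hp v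

theorem coord_frame {p₀ p : X} (hp : p ∈ e.frameSet hr p₀) (x : EuclideanSpace ℝ (Fin r)) :
    e.coord hr p₀ p (e.frame hr p₀ x) = x :=
  congrArg (fun T : EuclideanSpace ℝ (Fin r) →L[ℝ] EuclideanSpace ℝ (Fin r) => T x)
    (Ring.inverse_mul_cancel _ hp)

theorem coord_apply (p₀ p : X) (v : V) : e.coord hr p₀ p (e p v) = e.coord hr p₀ p v := by
  simp [coord, e.idem]

/-- The vector bundle whose fibres are the ranges of the idempotents, in local coordinates. -/
def core : VectorBundleCore ℝ X (EuclideanSpace ℝ (Fin r)) X where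
  baseSet := e.frameSet hr
  isOpen_baseSet := e.isOpen_frameSet hr
  indexAt := id
  mem_baseSet_at := e.mem_frameSet_self hr
  coordChange i j p := e.coord hr j p ∘L e.frame hr i
  coordChange_self _ _ hp x := e.coord_frame hr hp x
  continuousOn_coordChange i j :=
    (((e.contMDiffOn_coord hr j).clm_comp contMDiffOn_const).mono
      Set.inter_subset_right).continuousOn
  coordChange_comp i j k p hp x := by
    change e.coord hr k p (e.frame hr j (e.coord hr j p (e.frame hr i x))) =
      e.coord hr k p (e.frame hr i x)
    -- `coord` does not see the difference between a vector and its image under `e p`; once `e p` is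
    -- inserted, the frame and coframe at `j` cancel.
    rw [← coord_apply, apply_frame_coord _ _ hp.1.2, coord_apply]

instance : (e.core hr).IsContMDiff (𝓡 m) ∞ where
  contMDiffOn_coordChange _ j :=
    ((e.contMDiffOn_coord hr j).clm_comp contMDiffOn_const).mono Set.inter_subset_right

/-- The vector bundle whose fibres are the ranges of the idempotents. -/
def bundle : VBundle m X where
  rank := r
  -- The fibre at `p` is the coordinate space of the frame chosen at `p`, not the range itself:
  -- fibres have to be in `Type`, whereas `V` may live in a higher universe. `Realization` links the
  -- two.
  Fiber := (e.core hr).Fiber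

/-- Coordinates and vectors determine each other smoothly near `g y₀`, through `e ∘ frame` one way
and `coord` the other. The map `g` is there so that the bundle and its pullbacks are covered at
once. -/
theorem contMDiffWithinAt_coord_iff {c : ℕ} {Y : Type*} [TopologicalSpace Y]
    [ChartedSpace (EuclideanSpace ℝ (Fin c)) Y] {g : Y → X} (hg : ContMDiff (𝓡 c) (𝓡 m) ∞ g)
    {w : Y → V} {U : Set Y} {y₀ : Y} (hy₀ : y₀ ∈ U) :
    ContMDiffWithinAt (𝓡 c) 𝓘(ℝ, EuclideanSpace ℝ (Fin r)) ∞
      (fun y => e.coord hr (g y₀) (g y) (w y)) U y₀ ↔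
    ContMDiffWithinAt (𝓡 c) 𝓘(ℝ, V) ∞ (fun y => e (g y) (w y)) U y₀ := by
  have hmem := (e.isOpen_frameSet hr (g y₀)).mem_nhds (e.mem_frameSet_self hr (g y₀))
  constructor
  · intro h
    have h2 : ContMDiffWithinAt (𝓡 c) 𝓘(ℝ, V) ∞
        (fun y => (e (g y) ∘L e.frame hr (g y₀)) (e.coord hr (g y₀) (g y) (w y))) U y₀ :=
      ((e.smooth.comp hg).clm_comp contMDiff_const y₀).contMDiffWithinAt.clm_apply h
    refine h2.congr_of_eventuallyEq_of_mem ?_ hy₀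
    filter_upwards [mem_nhdsWithin_of_mem_nhds (hg.continuous.continuousAt hmem)] with y hy
    exact (e.apply_frame_coord hr hy _).symm
  · intro h
    have h1 : ContMDiffAt (𝓡 c) 𝓘(ℝ, V →L[ℝ] EuclideanSpace ℝ (Fin r)) ∞
        (fun y => e.coord hr (g y₀) (g y)) y₀ :=
      ((e.contMDiffOn_coord hr (g y₀)).contMDiffAt hmem).comp y₀ (hg y₀)
    have h2 : ContMDiffWithinAt (𝓡 c) 𝓘(ℝ, EuclideanSpace ℝ (Fin r)) ∞
        (fun y => e.coord hr (g y₀) (g y) (e (g y) (w y))) U y₀ :=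
      h1.contMDiffWithinAt.clm_apply h
    simpa only [coord_apply] using h2

/-- The pullback of a smooth family of idempotents. -/
def comp {c : ℕ} {Y : Type*} [TopologicalSpace Y] [ChartedSpace (EuclideanSpace ℝ (Fin c)) Y]
    (e : IdemFamily m X V) (g : C^∞⟮𝓡 c, Y; 𝓡 m, X⟯) : IdemFamily c Y V where
  toFun y := e (g y)
  smooth := e.smooth.comp g.contMDiff
  idem y := e.idem (g y)

end IdemFamily

/-- A realization of the vector bundle `B` as the range of a smooth family of idempotent
endomorphisms of a fixed vector space. -/
structure Realization {m : ℕ} {X : Type*} [TopologicalSpace X]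
    [ChartedSpace (EuclideanSpace ℝ (Fin m)) X] (B : VBundle m X) (V : Type*)
    [NormedAddCommGroup V] [NormedSpace ℝ V] where
  e : IdemFamily m X V
  emb : ∀ p, B.Fiber p →ₗ[ℝ] V
  lift : ∀ p, V →ₗ[ℝ] B.Fiber p
  lift_emb : ∀ p x, lift p (emb p x) = x
  emb_lift : ∀ p v, emb p (lift p v) = e p v
  smoothOn_iff : ∀ {s : ∀ p, B.Fiber p} {U : Set X}, IsOpen U →
    (B.SmoothOn s U ↔ ContMDiffOn (𝓡 m) 𝓘(ℝ, V) ∞ (fun p => emb p (s p)) U)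

namespace Realization

variable {m : ℕ} {X : Type*} [TopologicalSpace X] [ChartedSpace (EuclideanSpace ℝ (Fin m)) X]
  {V : Type*} [NormedAddCommGroup V] [NormedSpace ℝ V]

/-- The tautological realization of the bundle of ranges. -/
def ofIdemFamily [FiniteDimensional ℝ V] (e : IdemFamily m X V) {r : ℕ} (hr : e.HasRank r) :
    Realization (e.bundle hr) V where
  e := e
  emb p := (e p ∘L e.frame hr p).toLinearMap
  lift p := (e.coord hr p p).toLinearMap
  lift_emb p x :=
    (e.coord_apply hr p p _).trans (e.coord_frame hr (e.mem_frameSet_self hr p) x)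
  emb_lift p v := e.apply_frame_coord hr (e.mem_frameSet_self hr p) v
  smoothOn_iff {s _} _ := forall₂_congr fun _ hp₀ =>
    (contMDiffWithinAt_section (F := (e.bundle hr).Model) (E := (e.bundle hr).Fiber)).trans
      (e.contMDiffWithinAt_coord_iff hr (g := fun p => p) contMDiff_id
        (w := fun p => e.frame hr p (s p)) hp₀)

/-- The tautological realization of the pullback of the bundle of ranges. -/
def ofIdemFamilyPullback [FiniteDimensional ℝ V] (e : IdemFamily m X V) {r : ℕ} (hr : e.HasRank r)
    {c : ℕ} {Y : Type*} [TopologicalSpace Y] [ChartedSpace (EuclideanSpace ℝ (Fin c)) Y]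
    (g : C^∞⟮𝓡 c, Y; 𝓡 m, X⟯) : Realization ((e.bundle hr).pullback g) V where
  e := e.comp g
  emb p := (ofIdemFamily e hr).emb (g p)
  lift p := (ofIdemFamily e hr).lift (g p)
  lift_emb p := (ofIdemFamily e hr).lift_emb (g p)
  emb_lift p := (ofIdemFamily e hr).emb_lift (g p)
  smoothOn_iff {s _} _ := forall₂_congr fun _ hp₀ =>
    (contMDiffWithinAt_section (F := ((e.bundle hr).pullback g).Model)
      (E := ((e.bundle hr).pullback g).Fiber)).trans
      (e.contMDiffWithinAt_coord_iff hr (g := g) g.contMDiff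
        (w := fun p => e.frame hr (g p) (s p)) hp₀)

variable {B : VBundle m X} (R : Realization B V)

theorem emb_injective (p : X) : Function.Injective (R.emb p) :=
  Function.LeftInverse.injective (R.lift_emb p)

theorem smooth_emb (s : B.Sections) :
    ContMDiff (𝓡 m) 𝓘(ℝ, V) ∞ (fun p => R.emb p (s p)) :=
  contMDiffOn_univ.1 ((R.smoothOn_iff isOpen_univ).1 s.contMDiff.contMDiffOn)

theorem smoothOn_lift {f : X → V} {U : Set X} (hU : IsOpen U)
    (hf : ContMDiffOn (𝓡 m) 𝓘(ℝ, V) ∞ f U) : B.SmoothOn (fun p => R.lift p (f p)) U := by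
  rw [R.smoothOn_iff hU]
  simp only [R.emb_lift]
  exact R.e.smooth.contMDiffOn.clm_apply hf

/-- The section of `B` obtained by projecting a smooth `V`-valued function. -/
def liftSection (f : X → V) (hf : ContMDiff (𝓡 m) 𝓘(ℝ, V) ∞ f) : B.Sections :=
  ⟨fun p => R.lift p (f p), contMDiffOn_univ.1 (R.smoothOn_lift isOpen_univ hf.contMDiffOn)⟩

end Realization

/-! ## Subbundles cut out by smooth families of idempotents -/

section Cut

variable {m : ℕ} {X : Type*} [TopologicalSpace X] [ChartedSpace (EuclideanSpace ℝ (Fin m)) X]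
  {V : Type*} [NormedAddCommGroup V] [NormedSpace ℝ V] {B : VBundle m X}

/-- The subbundle `S` of the realized bundle `B` consists of the ranges of the idempotents `q`. -/
structure Realization.Cuts (R : Realization B V) (q : IdemFamily m X V) (S : Subbundle B) :
    Prop where
  e_apply : ∀ p v, R.e p (q p v) = q p v
  mem_iff : ∀ p x, x ∈ S.fiber p ↔ q p (R.emb p x) = R.emb p x

/-- The subbundle of `B` that consists of the ranges of the idempotents `q`. -/
def Realization.subbundle [FiniteDimensional ℝ V] (R : Realization B V) (q : IdemFamily m X V)
    (hq : ∀ p v, R.e p (q p v) = q p v) {r : ℕ} (hr : q.HasRank r) : Subbundle B where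
  rank := r
  -- The range of an idempotent is its fixed space.
  fiber p := LinearMap.eqLocus ((q p).toLinearMap ∘ₗ R.emb p) (R.emb p)
  exists_frame p₀ := by
    let b := (EuclideanSpace.basisFun (Fin r) ℝ).toBasis
    let T (p : X) : EuclideanSpace ℝ (Fin r) →ₗ[ℝ] B.Fiber p :=
      R.lift p ∘ₗ (q p ∘L q.frame hr p₀).toLinearMap
    have hT (p x) : R.emb p (T p x) = q p (q.frame hr p₀ x) :=
      (R.emb_lift p _).trans (hq p _)
    refine ⟨q.frameSet hr p₀, q.isOpen_frameSet hr p₀, q.mem_frameSet_self hr p₀,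
      fun i p => T p (b i), fun i => ?_, fun p hp => ⟨?_, ?_⟩⟩
    · exact R.smoothOn_lift (q.isOpen_frameSet hr p₀)
        (q.smooth.clm_apply contMDiff_const).contMDiffOn
    · refine b.linearIndependent.map' (T p) (LinearMap.ker_eq_bot.2 fun x y hxy => ?_)
      refine injective_comp_of_isUnit hp ?_
      change q p (q.frame hr p₀ x) = q p (q.frame hr p₀ y)
      rw [← hT, ← hT, hxy]
    · have hrange : Set.range (fun i => T p (b i)) = T p '' Set.range b := Set.range_comp (T p) b
      rw [hrange, ← Submodule.map_span, b.span_eq, Submodule.map_top]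
      ext x
      constructor
      · rintro ⟨z, rfl⟩
        change q p (R.emb p (T p z)) = R.emb p (T p z)
        rw [hT, q.idem]
      · intro hx
        replace hx : q p (R.emb p x) = R.emb p x := hx
        refine ⟨q.coord hr p₀ p (R.emb p x), R.emb_injective p ?_⟩
        rw [hT, q.apply_frame_coord hr hp, hx]

theorem Realization.cuts_subbundle [FiniteDimensional ℝ V] (R : Realization B V)
    (q : IdemFamily m X V) (hq : ∀ p v, R.e p (q p v) = q p v) {r : ℕ} (hr : q.HasRank r) :
    R.Cuts q (R.subbundle q hq hr) :=
  ⟨hq, fun _ _ => Iff.rfl⟩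

namespace Realization.Cuts

variable {R : Realization B V} {q : IdemFamily m X V} {S : Subbundle B} (h : R.Cuts q S)
include h

theorem emb_lift (p : X) (v : V) : R.emb p (R.lift p (q p v)) = q p v := by
  rw [R.emb_lift, h.e_apply]

theorem lift_mem (p : X) (v : V) : R.lift p (q p v) ∈ S.fiber p := by
  rw [h.mem_iff, h.emb_lift, q.idem]

theorem apply_emb {p : X} {x : B.Fiber p} (hx : x ∈ S.fiber p) : q p (R.emb p x) = R.emb p x :=
  (h.mem_iff p x).1 hx

end Realization.Cuts

end Cut

/-! ## Functions that are constant along the leaves -/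

section Leaves

variable {c : ℕ} {C : Type v} [TopologicalSpace C] [ChartedSpace (EuclideanSpace ℝ (Fin c)) C]
  [IsManifold (𝓡 c) ∞ C] {V : Type*} [NormedAddCommGroup V] [NormedSpace ℝ V]

theorem locallyConstant_of_mfderiv_eq_zero {d : ℕ} {L : Type*} [TopologicalSpace L]
    [ChartedSpace (EuclideanSpace ℝ (Fin d)) L] [IsManifold (𝓡 d) ∞ L] {f : L → V}
    (hf : ContMDiff (𝓡 d) 𝓘(ℝ, V) ∞ f) (h0 : ∀ x, mfderiv (𝓡 d) 𝓘(ℝ, V) f x = 0) :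
    IsLocallyConstant f := by
  rw [IsLocallyConstant.iff_eventually_eq]
  intro x
  let φ := chartAt (EuclideanSpace ℝ (Fin d)) x
  have hφx : φ x ∈ φ.target := φ.map_source (mem_chart_source _ x)
  obtain ⟨ε, hε, hball⟩ := Metric.isOpen_iff.1 φ.open_target (φ x) hφx
  have hderiv (z) (hz : z ∈ Metric.ball (φ x) ε) :
      HasFDerivAt (f ∘ φ.symm) (0 : EuclideanSpace ℝ (Fin d) →L[ℝ] V) z := by
    have h1 : MDifferentiableAt (𝓡 d) 𝓘(ℝ, V) f (φ.symm z) :=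
      (hf _).mdifferentiableAt (by simp)
    have h2 : MDifferentiableAt (𝓡 d) (𝓡 d) φ.symm z :=
      (contMDiffOn_chart_symm (n := ∞) |>.contMDiffAt
        (φ.open_target.mem_nhds (hball hz))).mdifferentiableAt (by simp)
    have h3 : HasMFDerivAt 𝓘(ℝ, EuclideanSpace ℝ (Fin d)) 𝓘(ℝ, V) (f ∘ φ.symm) z 0 := by
      have h4 := h1.hasMFDerivAt.comp z h2.hasMFDerivAt
      rw [h0] at h4
      simpa using h4
    exact h3.hasFDerivAt
  have hconst (z) (hz : z ∈ Metric.ball (φ x) ε) : (f ∘ φ.symm) z = (f ∘ φ.symm) (φ x) :=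
    Metric.isOpen_ball.is_const_of_fderiv_eq_zero (𝕜 := ℝ)
      (convex_ball (φ x) ε).isPreconnected
      (fun z hz => (hderiv z hz).differentiableAt.differentiableWithinAt)
      (fun z hz => (hderiv z hz).fderiv) hz (Metric.mem_ball_self hε)
  have hev : ∀ᶠ y in 𝓝 x, φ y ∈ Metric.ball (φ x) ε :=
    (φ.continuousAt (mem_chart_source _ x)).eventually (Metric.ball_mem_nhds _ hε)
  filter_upwards [hev, φ.open_source.mem_nhds (mem_chart_source _ x)] with y hy hys
  have := hconst (φ y) hy
  simpa only [Function.comp_apply, φ.left_inv hys, φ.left_inv (mem_chart_source _ x)] using this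

/-- The function `f` is constant along the leaves of `D`. -/
def IntegrableDistribution.LeafConst {Y : Type*} (D : IntegrableDistribution c C) (f : C → Y) :
    Prop :=
  ∀ p q, D.SameLeaf p q → f p = f q

variable {D : IntegrableDistribution c C}

/-- `D p` is the tangent space of an integral manifold through `p`, so derivatives in its directions
only depend on the restriction to that manifold. -/
theorem IntegrableDistribution.mvfderiv_congr {f g : C → V}
    (hf : ContMDiff (𝓡 c) 𝓘(ℝ, V) ∞ f) (hg : ContMDiff (𝓡 c) 𝓘(ℝ, V) ∞ g) {p : C}
    (h : ∀ q, D.SameLeaf q p → f q = g q) {x : TangentSpace (𝓡 c) p} (hx : x ∈ D.fiber p) :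
    mvfderiv (𝓡 c) f p x = mvfderiv (𝓡 c) g p x := by
  obtain ⟨N, y, rfl⟩ := D.exists_integralManifold p
  rw [← N.range_mfderiv y] at hx
  obtain ⟨z, rfl⟩ := hx
  have h1 : MDifferentiableAt (𝓡 N.dim) (𝓡 c) N.map y :=
    (N.immersion.contMDiff y).mdifferentiableAt (by simp)
  have h2 : MDifferentiableAt (𝓡 c) 𝓘(ℝ, V) f (N.map y) := (hf _).mdifferentiableAt (by simp)
  have h3 : MDifferentiableAt (𝓡 c) 𝓘(ℝ, V) g (N.map y) := (hg _).mdifferentiableAt (by simp)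
  have h4 : f ∘ N.map = g ∘ N.map := funext fun y' => h _ ⟨N, ⟨y', rfl⟩, ⟨y, rfl⟩⟩
  have h5 : mvfderiv (𝓡 N.dim) (f ∘ N.map) y z = mvfderiv (𝓡 N.dim) (g ∘ N.map) y z := by rw [h4]
  exact (mfderiv_comp_apply y h2 h1 z).symm.trans (h5.trans (mfderiv_comp_apply y h3 h1 z))

theorem IntegrableDistribution.LeafConst.mvfderiv_eq_zero {f : C → V} (hc : D.LeafConst f)
    (hf : ContMDiff (𝓡 c) 𝓘(ℝ, V) ∞ f) {p : C} {x : TangentSpace (𝓡 c) p} (hx : x ∈ D.fiber p) :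
    mvfderiv (𝓡 c) f p x = 0 := by
  rw [IntegrableDistribution.mvfderiv_congr hf (contMDiff_const (c := f p)) (fun q h => hc q p h)
    hx, mvfderiv_const]
  rfl

/-- Along the leaf through `p` the operator `a` may be frozen at its value `a p`, so the product
rule has no second term. -/
theorem IntegrableDistribution.LeafConst.mvfderiv_clm_apply {a : C → V →L[ℝ] V}
    (hc : D.LeafConst a) (ha : ContMDiff (𝓡 c) 𝓘(ℝ, V →L[ℝ] V) ∞ a) {f : C → V}
    (hf : ContMDiff (𝓡 c) 𝓘(ℝ, V) ∞ f) {p : C} {x : TangentSpace (𝓡 c) p} (hx : x ∈ D.fiber p) :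
    mvfderiv (𝓡 c) (fun y => a y (f y)) p x = a p (mvfderiv (𝓡 c) f p x) := by
  rw [IntegrableDistribution.mvfderiv_congr (g := fun y => a p (f y)) (ha.clm_apply hf)
    (contMDiff_const.clm_apply hf) (fun q h => by rw [hc q p h]) hx]
  have h1 : MDifferentiableAt 𝓘(ℝ, V) 𝓘(ℝ, V) (a p) (f p) :=
    (a p).differentiableAt.mdifferentiableAt
  have h2 : MDifferentiableAt (𝓡 c) 𝓘(ℝ, V) f p := (hf _).mdifferentiableAt (by simp)
  have h3 := mfderiv_comp p h1 h2
  have h4 : mfderiv 𝓘(ℝ, V) 𝓘(ℝ, V) (a p) (f p) = a p := by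
    rw [mfderiv_eq_fderiv]
    exact (a p).fderiv
  rw [h4] at h3
  exact congrArg (fun T => T x) h3

/-- Pulled back to an integral manifold, `f` has zero differential; integral manifolds are
connected. -/
theorem IntegrableDistribution.leafConst_of_mvfderiv_eq_zero {f : C → V}
    (hf : ContMDiff (𝓡 c) 𝓘(ℝ, V) ∞ f)
    (h0 : ∀ p, ∀ x ∈ D.fiber p, mvfderiv (𝓡 c) f p x = 0) : D.LeafConst f := by
  rintro _ _ ⟨N, ⟨a, rfl⟩, ⟨b, rfl⟩⟩
  have hN : ContMDiff (𝓡 N.dim) 𝓘(ℝ, V) ∞ (f ∘ N.map) := hf.comp N.immersion.contMDiff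
  refine (locallyConstant_of_mfderiv_eq_zero hN fun y => ?_).apply_eq_of_preconnectedSpace a b
  have h1 : MDifferentiableAt (𝓡 N.dim) (𝓡 c) N.map y :=
    (N.immersion.contMDiff y).mdifferentiableAt (by simp)
  have h2 : MDifferentiableAt (𝓡 c) 𝓘(ℝ, V) f (N.map y) := (hf _).mdifferentiableAt (by simp)
  rw [mfderiv_comp y h2 h1]
  ext1 z
  have hz : mfderiv (𝓡 N.dim) (𝓡 c) N.map y z ∈ D.fiber (N.map y) := by
    rw [← N.range_mfderiv y]
    exact ⟨z, rfl⟩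
  exact h0 _ _ hz

theorem contMDiff_mvfderiv_apply {f : C → V} (hf : ContMDiff (𝓡 c) 𝓘(ℝ, V) ∞ f)
    (X : VField c C) : ContMDiff (𝓡 c) 𝓘(ℝ, V) ∞ (fun p => mvfderiv (𝓡 c) f p (X p)) := by
  have h1 := hf.contMDiff_tangentMap (m := ∞) (by simp)
  have h2 := (contMDiff_snd_tangentBundle_modelSpace (n := ∞) V 𝓘(ℝ, V)).comp
    (h1.comp X.contMDiff)
  exact h2

end Leaves

/-! ## Grassmann connections -/

section Grassmann

variable {c : ℕ} {C : Type v} [TopologicalSpace C] [ChartedSpace (EuclideanSpace ℝ (Fin c)) C]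
  {V : Type*} [NormedAddCommGroup V] [NormedSpace ℝ V]
  {B : VBundle c C} {R : Realization B V} {q : IdemFamily c C V} {S : Subbundle B}

namespace Realization

/-- The derivative of a section of a realized bundle, as a vector-valued function. -/
def deriv (R : Realization B V) (s : B.Sections) (p : C) : TangentSpace (𝓡 c) p →L[ℝ] V :=
  mvfderiv (𝓡 c) (fun y => R.emb y (s y)) p

theorem deriv_add (R : Realization B V) (s t : B.Sections) (p : C) :
    R.deriv (s + t) p = R.deriv s p + R.deriv t p := by
  have h : (fun y => R.emb y ((s + t) y)) =
      (fun y => R.emb y (s y)) + fun y => R.emb y (t y) :=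
    funext fun y => map_add (R.emb y) _ _
  rw [deriv, h]
  exact mvfderiv_add ((R.smooth_emb s p).mdifferentiableAt (by simp))
    ((R.smooth_emb t p).mdifferentiableAt (by simp))

theorem deriv_smul (R : Realization B V) (f : C^∞⟮𝓡 c, C; ℝ⟯) (s : B.Sections) (p : C)
    (x : TangentSpace (𝓡 c) p) :
    R.deriv (f • s) p x = f p • R.deriv s p x + mvfderiv (𝓡 c) f p x • R.emb p (s p) := by
  have h : (fun y => R.emb y ((f • s) y)) = (f : C → ℝ) • fun y => R.emb y (s y) :=
    funext fun y => map_smul (R.emb y) _ _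
  rw [deriv, h, mvfderiv_smul ((f.contMDiff p).mdifferentiableAt (by simp))
    ((R.smooth_emb s p).mdifferentiableAt (by simp))]
  rfl

end Realization

namespace Realization.Cuts

variable (h : R.Cuts q S)

/-- The projection to the fibre over `p`, as a map between the fibres of the subbundle. -/
def transport (p p' : C) : S.fiber p →ₗ[ℝ] S.fiber p' :=
  ((R.lift p' ∘ₗ (q p').toLinearMap ∘ₗ R.emb p).codRestrict (S.fiber p')
    fun _ => h.lift_mem p' _) ∘ₗ (S.fiber p).subtype

theorem emb_transport (p p' : C) (x : S.fiber p) :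
    R.emb p' (h.transport p p' x) = q p' (R.emb p x) :=
  h.emb_lift p' _

variable [IsManifold (𝓡 c) ∞ C] {D : IntegrableDistribution c C}

/-- The covariant derivative `∇_x s = q (d s x)` on the subbundle cut out by `q`. -/
def covariantDer : CovariantDer S where
  toFun p x s := ⟨R.lift p (q p (R.deriv s.1 p x)), h.lift_mem p _⟩
  add_left p x y s := Subtype.ext (by simp)
  smul_left p a x s := Subtype.ext (by simp)
  add_right p x s t := Subtype.ext (by simp [R.deriv_add])
  leibniz p x f s := Subtype.ext (by
    change R.lift p (q p (R.deriv (f • s.1) p x)) = f p • R.lift p (q p (R.deriv s.1 p x)) +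
      mvfderiv (𝓡 c) f p x • s.1 p
    rw [R.deriv_smul, map_add, map_add, map_smul, map_smul, map_smul, map_smul,
      h.apply_emb (s.2 p), R.lift_emb])
  smooth X s := R.smoothOn_lift isOpen_univ
    (q.smooth.clm_apply (contMDiff_mvfderiv_apply (R.smooth_emb s.1) X)).contMDiffOn

/-- The `D`-connection `∇_x s = q (d s x)` on the subbundle cut out by `q`. -/
def connection (D : IntegrableDistribution c C) : DConnection D S where
  toFun p x s := h.covariantDer.toFun p x s
  exists_extension := ⟨h.covariantDer, fun _ _ _ => rfl⟩

-- Differentiate `s = q s` along the leaf, where `q` is constant. This is why the projection in the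
-- Grassmann connection is invisible in directions of `D`.
include h in
theorem deriv_eq (hq : D.LeafConst q) {s : B.Sections} (hs : s ∈ S.sections) {p : C}
    {x : TangentSpace (𝓡 c) p} (hx : x ∈ D.fiber p) : q p (R.deriv s p x) = R.deriv s p x := by
  have h1 : (fun y => R.emb y (s y)) = fun y => q y (R.emb y (s y)) :=
    funext fun y => (h.apply_emb (hs y)).symm
  conv_rhs => rw [deriv, h1]
  exact (hq.mvfderiv_clm_apply q.smooth (R.smooth_emb s) hx).symm

theorem emb_connection (hq : D.LeafConst q) (p : C) (x : D.fiber p) (s : S.sections) :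
    R.emb p ((h.connection D).toFun p x s) = R.deriv s.1 p x := by
  change R.emb p (R.lift p (q p _)) = _
  rw [h.emb_lift, h.deriv_eq hq s.2 x.2]

theorem isParallel_iff (hq : D.LeafConst q) (s : S.sections) :
    (h.connection D).IsParallel s ↔ D.LeafConst fun p => R.emb p (s.1 p) := by
  constructor
  · intro hs
    refine D.leafConst_of_mvfderiv_eq_zero (R.smooth_emb s.1) fun p x hx => ?_
    -- Parallelism is tested on vector fields only, so the vector is first extended to a field with
    -- values in `D`.
    obtain ⟨X, hX, rfl⟩ := D.exists_field p x hx
    have h1 := h.emb_connection hq p ⟨X p, hX p⟩ s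
    rw [hs X hX p] at h1
    exact h1.symm.trans (map_zero (R.emb p))
  · intro hs X hX p
    refine Subtype.ext (R.emb_injective p ?_)
    rw [h.emb_connection hq]
    exact (hs.mvfderiv_eq_zero (R.smooth_emb s.1) (hX p)).trans (map_zero (R.emb p)).symm

theorem preserves (hq : D.LeafConst q) {q' : IdemFamily c C V} {T : Subbundle B}
    (h' : R.Cuts q' T) (hq' : D.LeafConst q') (hle : T ≤ S) :
    (h.connection D).Preserves T hle := by
  intro X hX s p
  rw [h'.mem_iff, h.emb_connection hq]
  exact h'.deriv_eq hq' s.2 (hX p)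

theorem hasDerivAt_emb_comp {γ : ℝ → C} (hγ : D.IsLeafCurve γ) (s : B.Sections) (t : ℝ) :
    HasDerivAt (fun t => R.emb (γ t) (s (γ t)))
      (R.deriv s (γ t) (IntegrableDistribution.velocity γ t)) t := by
  obtain ⟨N, δ, hδ, rfl⟩ := hγ
  have h1 : MDifferentiableAt 𝓘(ℝ, ℝ) (𝓡 c) (N.map ∘ δ) t :=
    ((N.immersion.contMDiff.comp hδ) t).mdifferentiableAt (by simp)
  have h2 : MDifferentiableAt (𝓡 c) 𝓘(ℝ, V) (fun y => R.emb y (s y)) ((N.map ∘ δ) t) :=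
    (R.smooth_emb s _).mdifferentiableAt (by simp)
  let T : ℝ →L[ℝ] V := R.deriv s ((N.map ∘ δ) t) ∘L mfderiv 𝓘(ℝ, ℝ) (𝓡 c) (N.map ∘ δ) t
  have h3 : HasFDerivAt (fun t => R.emb ((N.map ∘ δ) t) (s ((N.map ∘ δ) t))) T t :=
    (h2.hasMFDerivAt.comp t h1.hasMFDerivAt).hasFDerivAt
  exact h3.hasDerivAt

/-- By the product rule, the covariant derivative along `γ` is the ordinary derivative of the
`V`-valued curve. -/
theorem hasDerivAt_of_isParallelAlong (hq : D.LeafConst q) {γ : ℝ → C} (hγ : D.IsLeafCurve γ)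
    {σ : ∀ t, S.fiber (γ t)} (hσ : (h.connection D).IsParallelAlong hγ σ) (t : ℝ) :
    HasDerivAt (fun t => R.emb (γ t) (σ t)) 0 t := by
  obtain ⟨r, e, f, hf, hev⟩ := hσ t
  have h1 : (fun t => R.emb (γ t) (σ t)) =ᶠ[𝓝 t]
      fun t => ∑ i, f i t • R.emb (γ t) ((e i).1 (γ t)) := by
    filter_upwards [hev] with t' ht'
    rw [ht'.1]
    simp [Subbundle.eval]
  have h2 : HasDerivAt (fun t => ∑ i, f i t • R.emb (γ t) ((e i).1 (γ t)))
      (∑ i, (f i t • R.deriv (e i).1 (γ t) (IntegrableDistribution.velocity γ t) +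
        _root_.deriv (f i) t • R.emb (γ t) ((e i).1 (γ t)))) t := by
    refine HasDerivAt.fun_sum fun i _ => ?_
    exact ((hf i).differentiable (by simp) t).hasDerivAt.smul (hasDerivAt_emb_comp hγ (e i).1 t)
  have h3 := congrArg (fun z : S.fiber (γ t) => R.emb (γ t) z) hev.self_of_nhds.2
  simp only [Submodule.coe_sum, Submodule.coe_add, Submodule.coe_smul, map_sum, map_add, map_smul,
    h.emb_connection hq, Submodule.coe_zero, map_zero] at h3
  refine (h2.congr_of_eventuallyEq h1).congr_deriv (Eq.trans ?_ h3)
  exact Finset.sum_congr rfl fun i _ => add_comm _ _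

theorem holonomyFree (hq : D.LeafConst q) : (h.connection D).HolonomyFree := by
  -- Within a leaf `q` is constant, so this map is the identity of `V` on the common range. Its
  -- values for points of different leaves play no role, as no leaf curve joins such points.
  refine ⟨h.transport, fun γ hγ x y => ⟨?_, ?_⟩⟩
  · rintro ⟨σ, hσ, rfl, rfl⟩
    have hd := h.hasDerivAt_of_isParallelAlong hq hγ hσ
    have h01 : R.emb (γ 1) (σ 1) = R.emb (γ 0) (σ 0) :=
      is_const_of_deriv_eq_zero (fun t => (hd t).differentiableAt) (fun t => (hd t).deriv) 1 0
    refine Subtype.ext (R.emb_injective _ ?_)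
    rw [h.emb_transport, ← h01, h.apply_emb (σ 1).2]
  · rintro rfl
    have hleaf (t : ℝ) : q (γ t) = q (γ 0) := by
      obtain ⟨N, δ, -, rfl⟩ := hγ
      exact hq _ _ ⟨N, ⟨δ t, rfl⟩, ⟨δ 0, rfl⟩⟩
    -- A single global section suffices to express the parallel curve: project the constant vector
    -- `x` by `q`. It is constant along leaves, so its coefficient can be `1`.
    have hsm : ContMDiff (𝓡 c) 𝓘(ℝ, V) ∞ fun p => q p (R.emb (γ 0) x) :=
      q.smooth.clm_apply contMDiff_const
    let s : S.sections := ⟨R.liftSection _ hsm, fun p => h.lift_mem p _⟩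
    have hs (p : C) : R.emb p (s.1 p) = q p (R.emb (γ 0) x) := h.emb_lift p _
    refine ⟨fun t => h.transport (γ 0) (γ t) x, fun t₀ => ⟨1, fun _ => s, fun _ _ => 1,
      fun _ => contDiff_const, Filter.Eventually.of_forall fun t => ⟨?_, ?_⟩⟩, ?_, rfl⟩
    · rw [Fin.sum_univ_one, one_smul]
      rfl
    · rw [Fin.sum_univ_one, one_smul, deriv_const, zero_smul, zero_add]
      refine Subtype.ext (R.emb_injective _ ?_)
      rw [h.emb_connection hq]
      have hc : D.LeafConst fun p => R.emb p (s.1 p) := fun p p' hpp => by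
        simp only [hs, hq p p' hpp]
      exact (hc.mvfderiv_eq_zero (R.smooth_emb s.1) (hγ.velocity_mem t)).trans
        (map_zero (R.emb _)).symm
    · refine Subtype.ext (R.emb_injective _ ?_)
      rw [h.emb_transport, h.apply_emb x.2]

end Realization.Cuts

end Grassmann

/-! ## Ranks of smooth families of idempotents -/

section Rank

theorem exists_eq_of_continuous_natCast {Y : Type*} [TopologicalSpace Y] [PreconnectedSpace Y]
    {f : Y → ℕ} (hf : Continuous fun y => (f y : ℝ)) : ∃ r, ∀ y, f y = r := by
  have hf' : Continuous f := Nat.isClosedEmbedding_coe_real.isInducing.continuous_iff.2 hf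
  rcases isEmpty_or_nonempty Y with hY | ⟨⟨y₀⟩⟩
  · exact ⟨0, fun y => hY.elim y⟩
  · exact ⟨f y₀, fun y => PreconnectedSpace.constant inferInstance hf'⟩

variable {m : ℕ} {X : Type*} [TopologicalSpace X] [ChartedSpace (EuclideanSpace ℝ (Fin m)) X]
  {V : Type*} [NormedAddCommGroup V] [NormedSpace ℝ V] [FiniteDimensional ℝ V]

/-- The rank of an idempotent is its trace. -/
theorem IdemFamily.continuous_finrank (e : IdemFamily m X V) :
    Continuous fun p => (Module.finrank ℝ (e p).range : ℝ) := by
  let τ : (V →L[ℝ] V) →ₗ[ℝ] ℝ := LinearMap.trace ℝ V ∘ₗ ContinuousLinearMap.coeLM ℝ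
  have h1 (p : X) : (Module.finrank ℝ (e p).range : ℝ) = τ (e p) := by
    have h2 : IsIdempotentElem (e p).toLinearMap := LinearMap.ext (e.idem p)
    exact (LinearMap.IsIdempotentElem.isProj_range _ h2).trace.symm
  simp only [h1]
  exact τ.continuous_of_finiteDimensional.comp e.smooth.continuous

theorem IdemFamily.exists_hasRank [PreconnectedSpace X] (e : IdemFamily m X V) :
    ∃ r, e.HasRank r :=
  exists_eq_of_continuous_natCast e.continuous_finrank

/-- Only `C/D` is connected, not necessarily `C`; the rank descends to `C/D`, and stays continuous
for the quotient topology. -/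
theorem IdemFamily.exists_hasRank_of_leafConst {c : ℕ} {C : Type v} [TopologicalSpace C]
    [ChartedSpace (EuclideanSpace ℝ (Fin c)) C] [IsManifold (𝓡 c) ∞ C]
    {D : IntegrableDistribution c C} [PreconnectedSpace D.LeafSpace] (q : IdemFamily c C V)
    (hq : D.LeafConst q) : ∃ r, q.HasRank r := by
  let f : D.LeafSpace → ℕ :=
    Quot.lift (fun p => Module.finrank ℝ (q p).range) fun p p' h => by rw [hq p p' h]
  have hf : Continuous fun y => (f y : ℝ) :=
    isQuotientMap_quot_mk.continuous_iff.2 q.continuous_finrank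
  obtain ⟨r, hr⟩ := exists_eq_of_continuous_natCast hf
  exact ⟨r, fun p => hr (Quot.mk _ p)⟩

end Rank

/-! ## Evaluation of endomorphisms of free modules -/

section Evaluation

variable {m : ℕ} {M : Type*} [TopologicalSpace M] [ChartedSpace (EuclideanSpace ℝ (Fin m)) M]
  {K : Type*} [CommRing K] [Algebra ℝ K] (φ : K →ₐ[ℝ] C^∞⟮𝓡 m, M; ℝ⟯) {n : Type*}

/-- Evaluation at `p` of the elements of a free module over an algebra of functions. -/
def evalAt (p : M) : (n →₀ K) →+ (n → ℝ) where
  toFun x i := φ (x i) p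
  map_zero' := by
    funext i
    rw [Finsupp.zero_apply, map_zero]
    rfl
  map_add' x y := by
    funext i
    rw [Finsupp.add_apply, map_add]
    rfl

theorem evalAt_smul (p : M) (f : K) (x : n →₀ K) : evalAt φ p (f • x) = φ f p • evalAt φ p x := by
  funext i
  change φ ((f • x) i) p = φ f p * φ (x i) p
  rw [Finsupp.smul_apply, smul_eq_mul, map_mul]
  rfl

variable [Fintype n]

/-- The constant element of a free module with given coordinates. -/
def constAt (K : Type*) [CommRing K] [Algebra ℝ K] (v : n → ℝ) : n →₀ K :=
  Finsupp.equivFunOnFinite.symm fun i => algebraMap ℝ K (v i)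

theorem evalAt_constAt (p : M) (v : n → ℝ) : evalAt φ p (constAt K v) = v := by
  funext i
  change φ (algebraMap ℝ K (v i)) p = v i
  rw [AlgHom.commutes]
  rfl

theorem contMDiff_evalAt (x : n →₀ K) :
    ContMDiff (𝓡 m) 𝓘(ℝ, n → ℝ) ∞ (fun p => evalAt φ p x) :=
  contMDiff_pi_space.2 fun i => (φ (x i)).contMDiff

open scoped Classical in
/-- The endomorphism of `ℝⁿ` obtained by evaluating an endomorphism of a free module at `p`. -/
def evalMap (T : (n →₀ K) →ₗ[K] (n →₀ K)) (p : M) : (n → ℝ) →L[ℝ] (n → ℝ) :=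
  ∑ j, (ContinuousLinearMap.proj (R := ℝ) (φ := fun _ : n => ℝ) j).smulRight
    (evalAt φ p (T (Finsupp.single j 1)))

theorem contMDiff_evalMap (T : (n →₀ K) →ₗ[K] (n →₀ K)) :
    ContMDiff (𝓡 m) 𝓘(ℝ, (n → ℝ) →L[ℝ] (n → ℝ)) ∞ (evalMap φ T) := by
  unfold evalMap
  refine contMDiff_finsetSum fun j _ => ?_
  have h := (ContinuousLinearMap.smulRightL ℝ (n → ℝ) (n → ℝ)
    (ContinuousLinearMap.proj (R := ℝ) (φ := fun _ : n => ℝ) j)).contMDiff (n := ∞)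
  exact h.comp (contMDiff_evalAt φ _)

/-- By `K`-linearity `T` is a matrix over `K`, and evaluation at a point is multiplicative. -/
theorem evalMap_evalAt (T : (n →₀ K) →ₗ[K] (n →₀ K)) (p : M) (x : n →₀ K) :
    evalMap φ T p (evalAt φ p x) = evalAt φ p (T x) := by
  classical
  have hx : x = ∑ j, x j • Finsupp.single j (1 : K) := by
    rw [← x.univ_sum_single]
    simp
  conv_rhs => rw [hx, map_sum, map_sum]
  simp only [evalMap, map_smul, evalAt_smul, sum_apply]
  rfl

end Evaluation

/-! ## Idempotent endomorphisms of free coisotropic modules -/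

theorem Finsupp.mem_supported_sup_submodule_iff {K n : Type*} [CommRing K] (J : Ideal K)
    (s : Set n) (x : n →₀ K) :
    x ∈ Finsupp.supported K K s ⊔ Finsupp.submodule (fun _ : n => J) ↔ ∀ i ∉ s, x i ∈ J := by
  constructor
  · intro hx i hi
    obtain ⟨y, hy, z, hz, rfl⟩ := Submodule.mem_sup.1 hx
    rw [Finsupp.add_apply, (Finsupp.mem_supported' K y).1 hy i hi, zero_add]
    exact hz i
  · intro hx
    classical
    refine Submodule.mem_sup.2 ⟨x.filter (· ∈ s), ?_, x.filter (fun i => ¬ i ∈ s), fun i => ?_,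
      x.filter_add_filter_not _⟩
    · exact (Finsupp.mem_supported' K _).2 fun i hi => Finsupp.filter_apply_neg _ _ hi
    · by_cases hi : i ∈ s
      · rw [Finsupp.filter_apply_neg (fun i => ¬ i ∈ s) _ (not_not.2 hi)]
        exact J.zero_mem
      · rw [Finsupp.filter_apply_pos (fun i => ¬ i ∈ s) _ hi]
        exact hx i hi

/-! ### Coordinate maps between `ℝ^(N_W)` and `ℝ^(N_T)` -/

namespace CoisoIndexSet

variable (N : CoisoIndexSet.{u}) [Fintype N.Tot] [Fintype N.Obs]

/-- Extension by zero along the structure map of a coisotropic index set. -/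
def inc : (N.Obs → ℝ) →L[ℝ] (N.Tot → ℝ) :=
  (Function.ExtendByZero.linearMap ℝ N.ι).toContinuousLinearMap

/-- Restriction along the structure map of a coisotropic index set. -/
def proj : (N.Tot → ℝ) →L[ℝ] (N.Obs → ℝ) :=
  (LinearMap.funLeft ℝ ℝ N.ι).toContinuousLinearMap

open scoped Classical in
/-- The projection onto the coordinates in the null part of a coisotropic index set. -/
def cut : (N.Obs → ℝ) →L[ℝ] (N.Obs → ℝ) :=
  ContinuousLinearMap.pi fun o => if o ∈ N.Null then ContinuousLinearMap.proj o else 0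

theorem inc_apply_of_notMem (w : N.Obs → ℝ) {t : N.Tot} (ht : t ∉ Set.range N.ι) :
    N.inc w t = 0 :=
  Function.extend_apply' _ _ _ ht

theorem cut_apply_of_mem (w : N.Obs → ℝ) {o : N.Obs} (ho : o ∈ N.Null) : N.cut w o = w o := by
  simp [cut, ho]

theorem cut_apply_of_notMem (w : N.Obs → ℝ) {o : N.Obs} (ho : o ∉ N.Null) : N.cut w o = 0 := by
  simp [cut, ho]

theorem cut_eq_self_iff (w : N.Obs → ℝ) : N.cut w = w ↔ ∀ o ∉ N.Null, w o = 0 := by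
  constructor
  · intro h o ho
    rw [← h, N.cut_apply_of_notMem w ho]
  · intro h
    funext o
    by_cases ho : o ∈ N.Null
    · exact N.cut_apply_of_mem w ho
    · rw [N.cut_apply_of_notMem w ho, h o ho]

theorem cut_cut (w : N.Obs → ℝ) : N.cut (N.cut w) = N.cut w :=
  (N.cut_eq_self_iff _).2 fun _ ho => N.cut_apply_of_notMem w ho

variable {N} (hN : Function.Injective N.ι)
include hN

theorem inc_apply (w : N.Obs → ℝ) (o : N.Obs) : N.inc w (N.ι o) = w o :=
  hN.extend_apply w 0 o

theorem proj_inc (w : N.Obs → ℝ) : N.proj (N.inc w) = w :=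
  funext fun o => inc_apply hN w o

end CoisoIndexSet

/-! ### Pointwise evaluation of free modules over `C^∞(M, C, D)` -/

section FreeModules

open CoisoModule

variable {m c : ℕ}
  {M : Type u} [TopologicalSpace M] [ChartedSpace (EuclideanSpace ℝ (Fin m)) M]
  {C : Type v} [TopologicalSpace C] [ChartedSpace (EuclideanSpace ℝ (Fin c)) C]
  [IsManifold (𝓡 c) ∞ C] (ι : C^∞⟮𝓡 c, C; 𝓡 m, M⟯) (D : IntegrableDistribution c C)

/-- The elements of `C^∞(M, C, D).Tot`, as functions on `M`. -/
def totFun : (smoothCoisoAlgebra ι D).Tot →ₐ[ℝ] C^∞⟮𝓡 m, M; ℝ⟯ := AlgHom.id ℝ C^∞⟮𝓡 m, M; ℝ⟯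

/-- The elements of `C^∞(M, C, D).Obs`, as functions on `M`. -/
def obsFun : (smoothCoisoAlgebra ι D).Obs →ₐ[ℝ] C^∞⟮𝓡 m, M; ℝ⟯ := (smoothObs ι D).val

variable {ι D}

theorem totFun_injective : Function.Injective (totFun ι D) := Function.injective_id

theorem obsFun_injective : Function.Injective (obsFun ι D) := Subtype.val_injective

theorem obsFun_leafConst (f : (smoothCoisoAlgebra ι D).Obs) :
    D.LeafConst fun p => obsFun ι D f (ι p) :=
  fun p q h => Subtype.property (show smoothObs ι D from f) p q h

variable {N : CoisoIndexSet.{u}}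

variable (ι D N) in
/-- Evaluation at `p` of the elements of the first component of a free module. -/
def evalTot (p : M) : (free (smoothCoisoAlgebra ι D) N).Tot →+ (N.Tot → ℝ) :=
  evalAt (totFun ι D) p

variable (ι D N) in
/-- Evaluation at `p` of the elements of the second component of a free module. -/
def evalObs (p : M) : (free (smoothCoisoAlgebra ι D) N).Obs →+ (N.Obs → ℝ) :=
  evalAt (obsFun ι D) p

theorem evalTot_ext {x y : (free (smoothCoisoAlgebra ι D) N).Tot}
    (h : ∀ p, evalTot ι D N p x = evalTot ι D N p y) : x = y :=
  Finsupp.ext fun t => totFun_injective (ContMDiffMap.ext fun p => congrFun (h p) t)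

theorem evalObs_ext {x y : (free (smoothCoisoAlgebra ι D) N).Obs}
    (h : ∀ p, evalObs ι D N p x = evalObs ι D N p y) : x = y :=
  Finsupp.ext fun t => obsFun_injective (ContMDiffMap.ext fun p => congrFun (h p) t)

theorem evalTot_smul (p : M) (f : (smoothCoisoAlgebra ι D).Tot)
    (x : (free (smoothCoisoAlgebra ι D) N).Tot) :
    evalTot ι D N p (f • x) = totFun ι D f p • evalTot ι D N p x :=
  evalAt_smul _ p f _

theorem evalObs_smul (p : M) (f : (smoothCoisoAlgebra ι D).Obs)
    (x : (free (smoothCoisoAlgebra ι D) N).Obs) :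
    evalObs ι D N p (f • x) = obsFun ι D f p • evalObs ι D N p x :=
  evalAt_smul _ p f _

theorem evalObs_leafConst (x : (free (smoothCoisoAlgebra ι D) N).Obs) :
    D.LeafConst fun p => evalObs ι D N (ι p) x :=
  fun p q h => funext fun o => obsFun_leafConst ((show N.Obs →₀ _ from x) o) p q h

variable [Fintype N.Tot] [Fintype N.Obs]

theorem contMDiff_evalTot (x : (free (smoothCoisoAlgebra ι D) N).Tot) :
    ContMDiff (𝓡 m) 𝓘(ℝ, N.Tot → ℝ) ∞ fun p => evalTot ι D N p x :=
  contMDiff_evalAt (totFun ι D) _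

theorem contMDiff_evalObs (x : (free (smoothCoisoAlgebra ι D) N).Obs) :
    ContMDiff (𝓡 m) 𝓘(ℝ, N.Obs → ℝ) ∞ fun p => evalObs ι D N p x :=
  contMDiff_evalAt (obsFun ι D) _

theorem exists_evalTot_eq (v : N.Tot → ℝ) :
    ∃ x : (free (smoothCoisoAlgebra ι D) N).Tot, ∀ p, evalTot ι D N p x = v :=
  ⟨constAt _ v, fun p => evalAt_constAt (totFun ι D) p v⟩

theorem exists_evalObs_eq (w : N.Obs → ℝ) :
    ∃ x : (free (smoothCoisoAlgebra ι D) N).Obs, ∀ p, evalObs ι D N p x = w :=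
  ⟨constAt _ w, fun p => evalAt_constAt (obsFun ι D) p w⟩

theorem evalTot_ι (hN : Function.Injective N.ι) (p : M)
    (x : (free (smoothCoisoAlgebra ι D) N).Obs) :
    evalTot ι D N p ((free (smoothCoisoAlgebra ι D) N).ι x) = N.inc (evalObs ι D N p x) := by
  let x' : N.Obs →₀ (smoothCoisoAlgebra ι D).Obs := x
  let y := x'.mapRange (smoothCoisoAlgebra ι D).ι (map_zero _)
  funext t
  by_cases ht : t ∈ Set.range N.ι
  · obtain ⟨o, rfl⟩ := ht
    rw [CoisoIndexSet.inc_apply hN]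
    exact congrArg (fun f => totFun ι D f p) (Finsupp.mapDomain_apply hN y o)
  · rw [CoisoIndexSet.inc_apply_of_notMem N _ ht]
    exact congrArg (fun f => totFun ι D f p) (Finsupp.mapDomain_of_notMem_range y t ht)

/-- Coordinates outside `N_0` have to lie in the vanishing ideal of `C`, so only the values on `C`
matter. -/
theorem mem_null_free_iff (x : (free (smoothCoisoAlgebra ι D) N).Obs) :
    x ∈ (free (smoothCoisoAlgebra ι D) N).Null ↔
      ∀ p, N.cut (evalObs ι D N (ι p) x) = evalObs ι D N (ι p) x := by
  simp only [N.cut_eq_self_iff]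
  refine (Finsupp.mem_supported_sup_submodule_iff (smoothCoisoAlgebra ι D).Null N.Null x).trans ?_
  exact ⟨fun h p o ho => h o ho p, fun h o ho p => h p o ho⟩

/-! ### Endomorphisms of free modules as families of matrices -/

variable (ε : free (smoothCoisoAlgebra ι D) N ⟶ free (smoothCoisoAlgebra ι D) N)

/-- The fibrewise action of an endomorphism of a free module on the first component. -/
def totMap (p : M) : (N.Tot → ℝ) →L[ℝ] (N.Tot → ℝ) := evalMap (totFun ι D) (Hom.tot ε) p

/-- The fibrewise action of an endomorphism of a free module on the second component. -/
def obsMap (p : M) : (N.Obs → ℝ) →L[ℝ] (N.Obs → ℝ) := evalMap (obsFun ι D) (Hom.obs ε) p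

theorem totMap_evalTot (p : M) (x : (free (smoothCoisoAlgebra ι D) N).Tot) :
    totMap ε p (evalTot ι D N p x) = evalTot ι D N p (Hom.tot ε x) :=
  evalMap_evalAt (totFun ι D) (Hom.tot ε) p x

theorem obsMap_evalObs (p : M) (x : (free (smoothCoisoAlgebra ι D) N).Obs) :
    obsMap ε p (evalObs ι D N p x) = evalObs ι D N p (Hom.obs ε x) :=
  evalMap_evalAt (obsFun ι D) (Hom.obs ε) p x

theorem contMDiff_totMap :
    ContMDiff (𝓡 m) 𝓘(ℝ, (N.Tot → ℝ) →L[ℝ] (N.Tot → ℝ)) ∞ (totMap ε) :=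
  contMDiff_evalMap (totFun ι D) (Hom.tot ε)

theorem contMDiff_obsMap :
    ContMDiff (𝓡 m) 𝓘(ℝ, (N.Obs → ℝ) →L[ℝ] (N.Obs → ℝ)) ∞ (obsMap ε) :=
  contMDiff_evalMap (obsFun ι D) (Hom.obs ε)

/-- The matrix entries belong to `C^∞_D(M)`. Testing on constant elements of the free module reduces
this to `evalObs_leafConst`. -/
theorem obsMap_leafConst : D.LeafConst fun p => obsMap ε (ι p) := by
  intro p q h
  refine ContinuousLinearMap.ext fun w => ?_
  obtain ⟨x, hx⟩ := exists_evalObs_eq (ι := ι) (D := D) w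
  have h1 := evalObs_leafConst (Hom.obs ε x) p q h
  simp only [← obsMap_evalObs, hx] at h1
  exact h1

theorem totMap_inc (hN : Function.Injective N.ι) (p : M) (w : N.Obs → ℝ) :
    totMap ε p (N.inc w) = N.inc (obsMap ε p w) := by
  obtain ⟨x, hx⟩ := exists_evalObs_eq (ι := ι) (D := D) w
  rw [← hx p, ← evalTot_ι hN, totMap_evalTot, Hom.comm ε, evalTot_ι hN, obsMap_evalObs]

/-- Constant elements with values in `ℝ^(N_0)` are null and `ε` preserves null elements. The
conclusion is confined to `C`, since nullity says nothing about other points. -/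
theorem cut_obsMap_cut (p : C) (w : N.Obs → ℝ) :
    N.cut (obsMap ε (ι p) (N.cut w)) = obsMap ε (ι p) (N.cut w) := by
  obtain ⟨x, hx⟩ := exists_evalObs_eq (ι := ι) (D := D) (N.cut w)
  have h1 : x ∈ (free (smoothCoisoAlgebra ι D) N).Null :=
    (mem_null_free_iff x).2 fun p => by rw [hx, N.cut_cut]
  have h2 := (mem_null_free_iff _).1 (Hom.map_null ε x h1) p
  rwa [← obsMap_evalObs, hx] at h2

/-! ### The families of idempotents cutting out the bundles -/

variable {ε} (hε : ε ≫ ε = ε)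
include hε

theorem totMap_totMap (p : M) (v : N.Tot → ℝ) : totMap ε p (totMap ε p v) = totMap ε p v := by
  obtain ⟨x, hx⟩ := exists_evalTot_eq (ι := ι) (D := D) v
  rw [← hx p, totMap_evalTot, totMap_evalTot]
  exact congrArg (fun φ => evalTot ι D N p (Hom.tot φ x)) hε

theorem obsMap_obsMap (p : M) (w : N.Obs → ℝ) : obsMap ε p (obsMap ε p w) = obsMap ε p w := by
  obtain ⟨x, hx⟩ := exists_evalObs_eq (ι := ι) (D := D) w
  rw [← hx p, obsMap_evalObs, obsMap_evalObs]
  exact congrArg (fun φ => evalObs ι D N p (Hom.obs φ x)) hε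

/-- The family of idempotents of `ℝ^(N.Tot)` given by an idempotent endomorphism. -/
def totFamily : IdemFamily m M (N.Tot → ℝ) where
  toFun := totMap ε
  smooth := contMDiff_totMap ε
  idem := totMap_totMap hε

variable (hN : Function.Injective N.ι)
include hN

/-- The family of idempotents of `ℝ^(N.Tot)` given by the second component of an idempotent
endomorphism. -/
def obsFamily : IdemFamily m M (N.Tot → ℝ) where
  toFun p := N.inc ∘L obsMap ε p ∘L N.proj
  smooth := contMDiff_const.clm_comp ((contMDiff_obsMap ε).clm_comp contMDiff_const)
  idem p v := by
    change N.inc (obsMap ε p (N.proj (N.inc (obsMap ε p (N.proj v))))) =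
      N.inc (obsMap ε p (N.proj v))
    rw [CoisoIndexSet.proj_inc hN, obsMap_obsMap hε]

theorem obsFamily_apply (p : M) (v : N.Tot → ℝ) :
    obsFamily hε hN p v = N.inc (obsMap ε p (N.proj v)) := rfl

theorem obsFamily_inc (p : M) (w : N.Obs → ℝ) :
    obsFamily hε hN p (N.inc w) = N.inc (obsMap ε p w) := by
  rw [obsFamily_apply, CoisoIndexSet.proj_inc hN]

theorem totFamily_obsFamily (p : M) (v : N.Tot → ℝ) :
    totFamily hε p (obsFamily hε hN p v) = obsFamily hε hN p v := by
  change totMap ε p (N.inc (obsMap ε p (N.proj v))) = N.inc (obsMap ε p (N.proj v))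
  rw [totMap_inc ε hN, obsMap_obsMap hε]

/-- The family of idempotents of `ℝ^(N.Tot)` over `C` given by the null part of an idempotent
endomorphism. -/
def nullFamily : IdemFamily c C (N.Tot → ℝ) where
  toFun p := N.inc ∘L obsMap ε (ι p) ∘L N.cut ∘L obsMap ε (ι p) ∘L N.proj
  smooth := by
    have h := (contMDiff_obsMap ε).comp ι.contMDiff
    exact contMDiff_const.clm_comp
      (h.clm_comp (contMDiff_const.clm_comp (h.clm_comp contMDiff_const)))
  idem p v := by
    change N.inc (obsMap ε (ι p) (N.cut (obsMap ε (ι p) (N.proj (N.inc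
      (obsMap ε (ι p) (N.cut (obsMap ε (ι p) (N.proj v))))))))) =
      N.inc (obsMap ε (ι p) (N.cut (obsMap ε (ι p) (N.proj v))))
    -- With `e = obsMap` and `π = cut`: `e π e e π e = e π e π e = e e π e = e π e`, by `π e π = e
    -- π`.
    rw [CoisoIndexSet.proj_inc hN, obsMap_obsMap hε, cut_obsMap_cut, obsMap_obsMap hε]

theorem nullFamily_apply (p : C) (v : N.Tot → ℝ) : nullFamily hε hN p v =
    N.inc (obsMap ε (ι p) (N.cut (obsMap ε (ι p) (N.proj v)))) := rfl

/-- Null elements of the free module thus give sections of `E_0`; `cut_proj_nullFamily` is the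
converse, that sections of `E_0` have null coordinates. -/
theorem nullFamily_inc_cut (p : C) (w : N.Obs → ℝ) :
    nullFamily hε hN p (N.inc (obsMap ε (ι p) (N.cut w))) =
      N.inc (obsMap ε (ι p) (N.cut w)) := by
  rw [nullFamily_apply, CoisoIndexSet.proj_inc hN, obsMap_obsMap hε, cut_obsMap_cut,
    obsMap_obsMap hε]

theorem cut_proj_nullFamily (p : C) (v : N.Tot → ℝ) :
    N.cut (N.proj (nullFamily hε hN p v)) = N.proj (nullFamily hε hN p v) := by
  rw [nullFamily_apply, CoisoIndexSet.proj_inc hN, cut_obsMap_cut]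

theorem obsFamily_nullFamily (p : C) (v : N.Tot → ℝ) :
    obsFamily hε hN (ι p) (nullFamily hε hN p v) = nullFamily hε hN p v := by
  rw [nullFamily_apply, obsFamily_inc, obsMap_obsMap hε]

theorem nullFamily_obsFamily (p : C) (v : N.Tot → ℝ) :
    nullFamily hε hN p (obsFamily hε hN (ι p) v) = nullFamily hε hN p v := by
  rw [nullFamily_apply, obsFamily_apply, CoisoIndexSet.proj_inc hN, obsMap_obsMap hε]
  rfl

/-- The complement of `nullFamily` in `obsFamily`. -/
def perpFamily : IdemFamily c C (N.Tot → ℝ) where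
  toFun p := obsFamily hε hN (ι p) - nullFamily hε hN p
  smooth := ((obsFamily hε hN).smooth.comp ι.contMDiff).sub (nullFamily hε hN).smooth
  idem p v := by
    simp only [sub_apply, map_sub, IdemFamily.idem, obsFamily_nullFamily, nullFamily_obsFamily]
    abel

theorem perpFamily_apply (p : C) (v : N.Tot → ℝ) :
    perpFamily hε hN p v = obsFamily hε hN (ι p) v - nullFamily hε hN p v := rfl

theorem obsFamily_perpFamily (p : C) (v : N.Tot → ℝ) :
    obsFamily hε hN (ι p) (perpFamily hε hN p v) = perpFamily hε hN p v := by
  rw [perpFamily_apply, map_sub, IdemFamily.idem, obsFamily_nullFamily]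

theorem nullFamily_perpFamily (p : C) (v : N.Tot → ℝ) :
    nullFamily hε hN p (perpFamily hε hN p v) = 0 := by
  rw [perpFamily_apply, map_sub, IdemFamily.idem, nullFamily_obsFamily, sub_self]

theorem obsFamily_leafConst : D.LeafConst ((obsFamily hε hN).comp ι) := fun p q h => by
  change N.inc ∘L obsMap ε (ι p) ∘L N.proj = N.inc ∘L obsMap ε (ι q) ∘L N.proj
  rw [show obsMap ε (ι p) = obsMap ε (ι q) from obsMap_leafConst ε p q h]

theorem nullFamily_leafConst : D.LeafConst (nullFamily hε hN) := fun p q h => by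
  change N.inc ∘L obsMap ε (ι p) ∘L N.cut ∘L obsMap ε (ι p) ∘L N.proj =
    N.inc ∘L obsMap ε (ι q) ∘L N.cut ∘L obsMap ε (ι q) ∘L N.proj
  rw [show obsMap ε (ι p) = obsMap ε (ι q) from obsMap_leafConst ε p q h]

theorem perpFamily_leafConst : D.LeafConst (perpFamily hε hN) := fun p q h => by
  change (obsFamily hε hN).comp ι p - nullFamily hε hN p =
    (obsFamily hε hN).comp ι q - nullFamily hε hN q
  rw [obsFamily_leafConst hε hN p q h, nullFamily_leafConst hε hN p q h]

end FreeModules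

/-! ## The module of sections of an idempotent endomorphism -/

/-- Two splittings of the same idempotent have isomorphic images. -/
def isoOfSplitIdempotent {𝓒 : Type*} [Category* 𝓒] {X Y Z : 𝓒} {r : X ⟶ Y} {i : Y ⟶ X} {f : X ⟶ Z}
    {g : Z ⟶ X} (hir : i ≫ r = 𝟙 Y) (hgf : g ≫ f = 𝟙 Z) (h : f ≫ g = r ≫ i) : Y ≅ Z where
  hom := i ≫ f
  inv := g ≫ r
  hom_inv_id := by
    rw [Category.assoc, ← Category.assoc f, h, Category.assoc, ← Category.assoc i, hir,
      Category.id_comp]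
  inv_hom_id := by
    rw [Category.assoc, ← Category.assoc r, ← h, Category.assoc, ← Category.assoc g, hgf,
      Category.id_comp]

section Sections

open CoisoModule

variable {m c : ℕ}
  {M : Type u} [TopologicalSpace M] [ChartedSpace (EuclideanSpace ℝ (Fin m)) M]
  {C : Type v} [TopologicalSpace C] [ChartedSpace (EuclideanSpace ℝ (Fin c)) C]
  [IsManifold (𝓡 c) ∞ C] {ι : C^∞⟮𝓡 c, C; 𝓡 m, M⟯} {D : IntegrableDistribution c C}
  {N : CoisoIndexSet.{u}} [Fintype N.Tot] [Fintype N.Obs]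
  {ε : free (smoothCoisoAlgebra ι D) N ⟶ free (smoothCoisoAlgebra ι D) N} (hε : ε ≫ ε = ε)
  (hN : Function.Injective N.ι) {rT rW r0 : ℕ} (hT : (totFamily hε).HasRank rT)
  (hW : (obsFamily hε hN).HasRank rW) (h0 : (nullFamily hε hN).HasRank r0)

/-- The realization of the bundle of ranges of `totFamily`. -/
abbrev totRealization : Realization ((totFamily hε).bundle hT) (N.Tot → ℝ) :=
  Realization.ofIdemFamily (totFamily hε) hT

/-- The realization of the restriction to `C` of the bundle of ranges of `totFamily`. -/
abbrev totRealizationPullback :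
    Realization (((totFamily hε).bundle hT).pullback ι) (N.Tot → ℝ) :=
  Realization.ofIdemFamilyPullback (totFamily hε) hT ι

/-- The subbundle of ranges of `obsFamily`. -/
abbrev obsSubbundle : Subbundle ((totFamily hε).bundle hT) :=
  (totRealization hε hT).subbundle (obsFamily hε hN) (totFamily_obsFamily hε hN) hW

theorem cuts_obsSubbundle_pullback : (totRealizationPullback hε hT).Cuts
    ((obsFamily hε hN).comp ι) ((obsSubbundle hε hN hT hW).pullback ι) :=
  ⟨fun p => totFamily_obsFamily hε hN (ι p), fun _ _ => Iff.rfl⟩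

theorem totFamily_nullFamily (p : C) (v : N.Tot → ℝ) :
    totFamily hε (ι p) (nullFamily hε hN p v) = nullFamily hε hN p v := by
  rw [← obsFamily_nullFamily, totFamily_obsFamily]

theorem totFamily_perpFamily (p : C) (v : N.Tot → ℝ) :
    totFamily hε (ι p) (perpFamily hε hN p v) = perpFamily hε hN p v := by
  rw [← obsFamily_perpFamily, totFamily_obsFamily]

/-- The subbundle of ranges of `nullFamily`. -/
abbrev nullSubbundle : Subbundle (((totFamily hε).bundle hT).pullback ι) :=
  (totRealizationPullback hε hT).subbundle (nullFamily hε hN) (totFamily_nullFamily hε hN) h0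

theorem cuts_nullSubbundle : (totRealizationPullback hε hT).Cuts (nullFamily hε hN)
    (nullSubbundle hε hN hT h0) :=
  Realization.cuts_subbundle _ _ _ _

/-- The Grassmann connection on the restriction to `C` of the bundle of ranges of `obsFamily`. -/
abbrev obsConnection : DConnection D ((obsSubbundle hε hN hT hW).pullback ι) :=
  (cuts_obsSubbundle_pullback hε hN hT hW).connection D

/-- The coisotropic module of sections defined by an idempotent endomorphism. -/
abbrev rangeSections : CoisoModule (smoothCoisoAlgebra ι D) :=
  sectionModule ι D (obsSubbundle hε hN hT hW) (nullSubbundle hε hN hT h0)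
    (obsConnection hε hN hT hW)

theorem contMDiff_inc_evalObs (x : (free (smoothCoisoAlgebra ι D) N).Obs) :
    ContMDiff (𝓡 m) 𝓘(ℝ, N.Tot → ℝ) ∞ fun p => N.inc (evalObs ι D N p x) :=
  contMDiff_const.clm_apply (contMDiff_evalObs x)

include hN in
theorem totFamily_inc (p : M) (w : N.Obs → ℝ) :
    totFamily hε p (N.inc w) = N.inc (obsMap ε p w) :=
  totMap_inc ε hN p w

/-- The section of `E_T` defined by an element of the free module. -/
def totSection : (free (smoothCoisoAlgebra ι D) N).Tot →ₗ[(smoothCoisoAlgebra ι D).Tot]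
    (rangeSections hε hN hT hW h0).Tot where
  toFun x := (totRealization hε hT).liftSection _ (contMDiff_evalTot x)
  map_add' x y := ContMDiffSection.ext fun p => by
    change (totRealization hε hT).lift p (evalTot ι D N p (x + y)) =
      (totRealization hε hT).lift p (evalTot ι D N p x) +
      (totRealization hε hT).lift p (evalTot ι D N p y)
    rw [map_add, map_add]
  map_smul' f x := ContMDiffSection.ext fun p => by
    change (totRealization hε hT).lift p (evalTot ι D N p (f • x)) =
      totFun ι D f p • (totRealization hε hT).lift p (evalTot ι D N p x)
    rw [evalTot_smul, map_smul]

include hN in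
theorem emb_lift_inc (p : M) (w : N.Obs → ℝ) :
    (totRealization hε hT).emb p ((totRealization hε hT).lift p (N.inc w)) =
      N.inc (obsMap ε p w) :=
  ((totRealization hε hT).emb_lift p _).trans (totFamily_inc hε hN p w)

/-- The section of `E_W` defined by an element of the free module. -/
def obsSection : (free (smoothCoisoAlgebra ι D) N).Obs →ₗ[(smoothCoisoAlgebra ι D).Obs]
    (rangeSections hε hN hT hW h0).Obs where
  toFun x := ⟨(totRealization hε hT).liftSection _ (contMDiff_inc_evalObs x), by
    have h1 (p : M) : obsFamily hε hN p ((totRealization hε hT).emb p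
        ((totRealization hε hT).lift p (N.inc (evalObs ι D N p x)))) =
        (totRealization hε hT).emb p
          ((totRealization hε hT).lift p (N.inc (evalObs ι D N p x))) := by
      rw [emb_lift_inc hε hN, obsFamily_inc, obsMap_obsMap hε]
    refine ⟨h1, ?_⟩
    -- Parallel amounts to leafwise constant, and the vector in question is the value of `ε x`,
    -- whose coordinates are in `C^∞_D(M)`.
    refine ((cuts_obsSubbundle_pullback hε hN hT hW).isParallel_iff
      (obsFamily_leafConst hε hN) _).2 fun p q h => ?_
    refine (emb_lift_inc hε hN hT (ι p) (evalObs ι D N (ι p) x)).trans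
      (Eq.trans ?_ (emb_lift_inc hε hN hT (ι q) (evalObs ι D N (ι q) x)).symm)
    rw [obsMap_evalObs, obsMap_evalObs]
    exact congrArg N.inc (evalObs_leafConst (Hom.obs ε x) p q h)⟩
  map_add' x y := Subtype.ext (ContMDiffSection.ext fun p => by
    change (totRealization hε hT).lift p (N.inc (evalObs ι D N p (x + y))) =
      (totRealization hε hT).lift p (N.inc (evalObs ι D N p x)) +
      (totRealization hε hT).lift p (N.inc (evalObs ι D N p y))
    rw [map_add, map_add, map_add])
  map_smul' f x := Subtype.ext (ContMDiffSection.ext fun p => by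
    change (totRealization hε hT).lift p (N.inc (evalObs ι D N p (f • x))) =
      obsFun ι D f p • (totRealization hε hT).lift p (N.inc (evalObs ι D N p x))
    rw [evalObs_smul, map_smul, map_smul])

/-- The morphism from the free module to the module of sections. -/
def freeToSections : free (smoothCoisoAlgebra ι D) N ⟶ rangeSections hε hN hT hW h0 where
  tot := totSection hε hN hT hW h0
  obs := obsSection hε hN hT hW h0
  comm x := ContMDiffSection.ext fun p =>
    congrArg ((totRealization hε hT).lift p) (evalTot_ι hN p x)
  map_null x hx p := by
    change nullFamily hε hN p ((totRealization hε hT).emb (ι p)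
        ((totRealization hε hT).lift (ι p) (N.inc (evalObs ι D N (ι p) x)))) =
      (totRealization hε hT).emb (ι p)
        ((totRealization hε hT).lift (ι p) (N.inc (evalObs ι D N (ι p) x)))
    rw [emb_lift_inc hε hN, ← (mem_null_free_iff x).1 hx p, nullFamily_inc_cut]

/-- The coordinates of a section of `E_T`. -/
def totCoord : (rangeSections hε hN hT hW h0).Tot →ₗ[(smoothCoisoAlgebra ι D).Tot]
    (free (smoothCoisoAlgebra ι D) N).Tot where
  toFun s := Finsupp.equivFunOnFinite.symm fun t =>
    (⟨fun p => (totRealization hε hT).emb p ((show ((totFamily hε).bundle hT).Sections from s) p) t,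
      contMDiff_pi_space.1 ((totRealization hε hT).smooth_emb _) t⟩ : C^∞⟮𝓡 m, M; ℝ⟯)
  map_add' _ _ := Finsupp.ext fun i => ContMDiffMap.ext fun p =>
    congrFun (map_add ((totRealization hε hT).emb p) _ _) i
  map_smul' f _ := Finsupp.ext fun i => ContMDiffMap.ext fun p =>
    congrFun (map_smul ((totRealization hε hT).emb p) (totFun ι D f p) _) i

theorem leafConst_emb (s : (rangeSections hε hN hT hW h0).Obs) :
    D.LeafConst fun p => (totRealization hε hT).emb (ι p)
      ((show invariantSections ι D (obsSubbundle hε hN hT hW)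
        (obsConnection hε hN hT hW) from s).1 (ι p)) := by
  obtain ⟨s, hs, hs'⟩ := s
  exact ((cuts_obsSubbundle_pullback hε hN hT hW).isParallel_iff
      (obsFamily_leafConst hε hN) _).1 hs'

/-- The coordinates of a section of `E_W`. -/
def obsCoord : (rangeSections hε hN hT hW h0).Obs →ₗ[(smoothCoisoAlgebra ι D).Obs]
    (free (smoothCoisoAlgebra ι D) N).Obs where
  toFun s := Finsupp.equivFunOnFinite.symm fun o =>
    (⟨⟨fun p => (totRealization hε hT).emb p ((show invariantSections ι D
        (obsSubbundle hε hN hT hW) (obsConnection hε hN hT hW) from s).1 p) (N.ι o),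
      contMDiff_pi_space.1 ((totRealization hε hT).smooth_emb _) (N.ι o)⟩,
      fun p q h => congrFun (leafConst_emb hε hN hT hW h0 s p q h) (N.ι o)⟩ : smoothObs ι D)
  map_add' _ _ := Finsupp.ext fun i => Subtype.ext (ContMDiffMap.ext fun p =>
    congrFun (map_add ((totRealization hε hT).emb p) _ _) (N.ι i))
  map_smul' f _ := Finsupp.ext fun i => Subtype.ext (ContMDiffMap.ext fun p =>
    congrFun (map_smul ((totRealization hε hT).emb p) (obsFun ι D f p) _) (N.ι i))

theorem inc_proj_emb (s : invariantSections ι D (obsSubbundle hε hN hT hW)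
    (obsConnection hε hN hT hW)) (p : M) :
    N.inc (N.proj ((totRealization hε hT).emb p (s.1 p))) =
      (totRealization hε hT).emb p (s.1 p) := by
  obtain ⟨s, hs, -⟩ := s
  have h1 : obsFamily hε hN p ((totRealization hε hT).emb p (s p)) =
      (totRealization hε hT).emb p (s p) := hs p
  change N.inc (N.proj ((totRealization hε hT).emb p (s p))) = _
  rw [← h1, obsFamily_apply, CoisoIndexSet.proj_inc hN]

/-- The morphism from the module of sections to the free module. -/
def sectionsToFree : rangeSections hε hN hT hW h0 ⟶ free (smoothCoisoAlgebra ι D) N where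
  tot := totCoord hε hN hT hW h0
  obs := obsCoord hε hN hT hW h0
  comm s := evalTot_ext fun p => by
    rw [evalTot_ι hN]
    exact (inc_proj_emb hε hN hT hW s p).symm
  map_null s hs := (mem_null_free_iff _).2 fun p => by
    have h1 : nullFamily hε hN p ((totRealization hε hT).emb (ι p) (s.1 (ι p))) =
      (totRealization hε hT).emb (ι p) (s.1 (ι p)) := hs p
    have h2 := cut_proj_nullFamily hε hN p ((totRealization hε hT).emb (ι p) (s.1 (ι p)))
    rw [h1] at h2
    exact h2

theorem sectionsToFree_freeToSections :
    sectionsToFree hε hN hT hW h0 ≫ freeToSections hε hN hT hW h0 = 𝟙 _ := by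
  refine Hom.ext_apply (fun s => ContMDiffSection.ext fun p => ?_)
    (fun s => Subtype.ext (ContMDiffSection.ext fun p => ?_))
  · exact (totRealization hε hT).lift_emb p _
  · exact (congrArg ((totRealization hε hT).lift p) (inc_proj_emb hε hN hT hW s p)).trans
      ((totRealization hε hT).lift_emb p _)

/-- Projecting to the fibre and embedding again is, at each point, the matrix of `ε`; elements of a
free module are determined by their values. -/
theorem freeToSections_sectionsToFree :
    freeToSections hε hN hT hW h0 ≫ sectionsToFree hε hN hT hW h0 = ε := by
  refine Hom.ext_apply (fun x => evalTot_ext fun p => ?_) (fun x => evalObs_ext fun p => ?_)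
  · exact ((totRealization hε hT).emb_lift p _).trans (totMap_evalTot ε p x)
  · exact (congrArg N.proj (emb_lift_inc hε hN hT p _)).trans
      ((CoisoIndexSet.proj_inc hN _).trans (obsMap_evalObs ε p x))

end Sections

end

/-! ### Assembly of the main theorem -/

theorem mainTheorem2 {m c : ℕ}
    {M : Type u} [TopologicalSpace M] [ChartedSpace (EuclideanSpace ℝ (Fin m)) M]
    [IsManifold (𝓡 m) ∞ M] [T2Space M] [SecondCountableTopology M]
    {C : Type v} [TopologicalSpace C] [ChartedSpace (EuclideanSpace ℝ (Fin c)) C]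
    [IsManifold (𝓡 c) ∞ C] [T2Space C] [SecondCountableTopology C]
    (ι : C^∞⟮𝓡 c, C; 𝓡 m, M⟯) (hι : Manifold.IsImmersion (𝓡 c) (𝓡 m) ∞ ι)
    (hι_inj : Function.Injective ι) (D : IntegrableDistribution c C)
    (hM : PreconnectedSpace M) (hD : PreconnectedSpace D.LeafSpace)
    (P : CoisoModule (smoothCoisoAlgebra ι D))
    (hP_fg : P.FinitelyGenerated) (hP_proj : P.RegularProjective) :
    ∃ (ET : VBundle m M) (EW : Subbundle ET) (E0 : Subbundle (ET.pullback ι))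
      (h0 : E0 ≤ EW.pullback ι) (nab : DConnection D (EW.pullback ι)),
      nab.HolonomyFree ∧ nab.Preserves E0 h0 ∧
      Nonempty (P ≅ sectionModule ι D EW E0 nab) ∧
      ∃ (E0perp : Subbundle (ET.pullback ι)) (hperp : E0perp ≤ EW.pullback ι)
        (nab0 : DConnection D E0) (nabperp : DConnection D E0perp),
        (∀ p, E0.fiber p ⊓ E0perp.fiber p = ⊥ ∧
          E0.fiber p ⊔ E0perp.fiber p = (EW.pullback ι).fiber p) ∧
        nab0.HolonomyFree ∧ nabperp.HolonomyFree ∧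
        ∀ (p : C) (x : D.fiber p) (s : E0.sections) (t : E0perp.sections),
          (nab.toFun p x (Subbundle.incl h0 s + Subbundle.incl hperp t) :
              (ET.pullback ι).Fiber p) =
            nab0.toFun p x s + nabperp.toFun p x t := by
  obtain ⟨N, hNT, hNO, hN, r, i, hir⟩ := CoisoModule.exists_retract_free hP_fg hP_proj
  have := Fintype.ofFinite N.Tot
  have := Fintype.ofFinite N.Obs
  have hε : (r ≫ i) ≫ r ≫ i = r ≫ i := by
    rw [Category.assoc, ← Category.assoc i r i, hir, Category.id_comp]
  have cW := obsFamily_leafConst hε hN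
  have c0 := nullFamily_leafConst hε hN
  have cP := perpFamily_leafConst hε hN
  -- The families for `E_T` and `E_W` live over the connected `M`; those for `E_0` and its
  -- complement only over `C`, where constant rank comes from `C/D`.
  obtain ⟨rT, hT⟩ := (totFamily hε).exists_hasRank
  obtain ⟨rW, hW⟩ := (obsFamily hε hN).exists_hasRank
  obtain ⟨r0, h0⟩ := (nullFamily hε hN).exists_hasRank_of_leafConst c0
  obtain ⟨rP, hP⟩ := (perpFamily hε hN).exists_hasRank_of_leafConst cP
  let R := totRealizationPullback hε hT
  let EP := R.subbundle (perpFamily hε hN) (totFamily_perpFamily hε hN) hP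
  have kW := cuts_obsSubbundle_pullback hε hN hT hW
  have k0 := cuts_nullSubbundle hε hN hT h0
  have kP : R.Cuts (perpFamily hε hN) EP := Realization.cuts_subbundle _ _ _ _
  have le0 : nullSubbundle hε hN hT h0 ≤ (obsSubbundle hε hN hT hW).pullback ι := fun p x hx => by
    rw [kW.mem_iff, ← k0.apply_emb hx]
    exact obsFamily_nullFamily hε hN p _
  have leP : EP ≤ (obsSubbundle hε hN hT hW).pullback ι := fun p x hx => by
    rw [kW.mem_iff, ← kP.apply_emb hx]
    exact obsFamily_perpFamily hε hN p _
  refine ⟨(totFamily hε).bundle hT, obsSubbundle hε hN hT hW, nullSubbundle hε hN hT h0, le0,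
    obsConnection hε hN hT hW, kW.holonomyFree cW, kW.preserves cW k0 c0 le0,
    ⟨isoOfSplitIdempotent hir (sectionsToFree_freeToSections hε hN hT hW h0)
      (freeToSections_sectionsToFree hε hN hT hW h0)⟩, EP, leP, k0.connection D,
    kP.connection D, fun p => ⟨?_, le_antisymm (sup_le (le0 p) (leP p)) fun x hx => ?_⟩,
    k0.holonomyFree c0, kP.holonomyFree cP, fun p x s t => R.emb_injective p ?_⟩
  · refine (Submodule.eq_bot_iff _).2 fun x hx => R.emb_injective p ?_
    have h1 := nullFamily_perpFamily hε hN p (R.emb p x)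
    rw [kP.apply_emb hx.2] at h1
    rw [← k0.apply_emb hx.1, map_zero]
    exact h1
  · refine Submodule.mem_sup.2 ⟨_, k0.lift_mem p (R.emb p x), _, kP.lift_mem p (R.emb p x), ?_⟩
    refine R.emb_injective p ?_
    rw [map_add, k0.emb_lift, kP.emb_lift, ← kW.apply_emb hx, perpFamily_apply]
    exact (add_sub_cancel _ _).trans ((obsFamily hε hN).idem (ι p) _)
  · rw [kW.emb_connection cW]
    refine (congrArg (fun T => T x.1) (R.deriv_add s.1 t.1 p)).trans ?_
    rw [map_add, k0.emb_connection c0, kP.emb_connection cP]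
    rfl
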